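/- **Setting.** Let $\mathcal X$ (states) and $\mathcal A$ (actions) be standard Borel spaces (for instance Borel subsets of Euclidean spaces), $P$ a probability kernel from $\mathcal X\times\mathcal A$ to $\mathcal X$, $r:\mathcal X\times\mathcal A\to\mathbb R$ bounded and measurable, $\gamma\in(0,1)$, and $\pi^{\mathrm{ref}}$ a reference policy; a policy is a probability kernel from $\mathcal X$ to $\mathcal A$. For a policy $\pi$ let $(X_t,A_t)_{t\ge0}$ be the induced Markov chain, with $X_{t+1}\sim P_{X_t,A_t}$ and $A_{t+1}\sim\pi_{X_{t+1}}$. Write $\mathrm{KL}_\pi(x)=\mathrm{KL}(\pi_x\,\|\,\pi^{\mathrm{ref}}_x)$ and, conditionally on $X_0=x,A_0=a$, $$\zeta^\pi_{x,a}=\mathrm{Law}\Big(\sum_{t\ge0}\gamma^t r(X_t,A_t)\Big),\qquad \varsigma^{\tau,\pi}_{x,a}=\mathrm{Law}\Big(r(X_0,A_0)+\sum_{t\ge1}\gamma^t\big(r(X_t,A_t)-\tau\,\mathrm{KL}_\pi(X_t)\big)\Big).$$ Let $q^\pi$ be the mean of $\zeta^\pi$, and for a kernel $\varsigma$ from $\mathcal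 X\times\mathcal A$ to $\mathbb R$ let $(\mathcal Q\varsigma)(x,a)=\int z\,d\varsigma_{x,a}(z)$. For $\tau>0$ put $(\mathcal V_\tau q)(x)=\tau\log\int e^{q(x,a)/\tau}\,d\pi^{\mathrm{ref}}_x(a)$, let $\mathcal B_\tau q$ be the policy with density $e^{(q(x,a)-(\mathcal V_\tau q)(x))/\tau}$ with respect to $\pi^{\mathrm{ref}}_x$, let $q^\star_\tau$ be the unique bounded measurable solution of $q(x,a)=r(x,a)+\gamma\int \mathcal V_\tau q\,dP_{x,a}$, and let $\pi^{\tau,\star}=\mathcal B_\tau q^\star_\tau$. Let $q^\star_{\mathrm{ref}}$ be the unique bounded measurable solution of $q(x,a)=r(x,a)+\gamma\int \operatorname{ess\,sup}_{\pi^{\mathrm{ref}}_{x'}}q(x',\cdot)\,dP_{x,a}(x')$. A policy $\pi$ is $\epsilon$-reference-optimal if $q^\pi\ge q^\star_{\mathrm{ref}}-\epsilon$ everywhere. The soft distributional optimality operator $\mathcal T_\tau$ sends $\varsigma$ to the kernel whose value at $(x,a)$ is the law of $r(x,a)+\gamma Z-\gamma\tau\,\mathrm{KL}_{\pi}(X')$,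 where $\pi=\mathcal B_\tau\mathcal Q\varsigma$, $X'\sim P_{x,a}$, $A'\sim\pi_{X'}$ and $Z\sim\varsigma_{X',A'}$. For $p,p'\in[1,\infty)$ and a probability measure $\omega$ on $\mathcal X\times\mathcal A$ let $\bar w_{p,p'}(\lambda,\lambda')=\big(\int w_p(\lambda_y,\lambda'_y)^{p'}\,d\omega(y)\big)^{1/p'}$, with $w_p$ the $p$-Wasserstein distance on $\mathbb R$. **Theorem.** Assume that there is a constant $p_{\min}>0$ with $$\inf_{\tau>0}\inf_{x}\pi^{\mathrm{ref}}_x\big(\{a: q^\star_\tau(x,a)=\operatorname{ess\,sup}_{\pi^{\mathrm{ref}}_x}q^\star_\tau(x,\cdot)\}\big)\ge p_{\min}.$$ Let $p,p'\in[1,\infty)$ and let $\omega$ be a probability measure on $\mathcal X\times\mathcal A$. For all $\epsilon,\delta>0$ there is $\tau>0$ such that $\bar w_{p,p'}(\varsigma^{\tau,\pi^{\tau,\star}},\zeta^{\pi^{\tau,\star}})\le\delta/2$ and $\pi^{\tau,\star}$ is $\epsilon/2$-reference-optimal. Moreover, with this same $\tau$, for every probability kernel $\varsigma$ from $\mathcal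 X\times\mathcal A$ to $\mathbb R$ with $\sup_{x,a}\int|z|^p\,d\varsigma_{x,a}(z)<\infty$ there is $N\in\mathbb N$ such that, for all $n\ge N$, the iterates $\varsigma^0=\mathcal T_\tau\varsigma$, $\varsigma^{n+1}=\mathcal T_\tau\varsigma^n$ satisfy $\bar w_{p,p'}(\varsigma^n,\zeta^{\pi^{\tau,\star}})\le\delta$, and $\mathcal B_\tau\mathcal Q\varsigma^n$ is $\epsilon$-reference-optimal. -/

import Mathlib

open MeasureTheory ProbabilityTheory Set Function
open scoped ENNReal

noncomputable section

namespace DERL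

universe u v

variable {S : Type u} {A : Type v} [MeasurableSpace S] [MeasurableSpace A]

/-- A discounted Markov decision process with state space `S` and action space `A`: a transition
probability kernel `P`, a bounded measurable reward `r`, and a discount factor `γ ∈ (0, 1)`. -/
structure MDP (S : Type u) (A : Type v) [MeasurableSpace S] [MeasurableSpace A] where
  P : Kernel (S × A) S
  markov_P : IsMarkovKernel P
  r : S × A → ℝ
  measurable_r : Measurable r
  bounded_r : ∃ C : ℝ, ∀ y, |r y| ≤ C
  γ : ℝ
  γ_pos : 0 < γ
  γ_lt_one : γ < 1

instance (M : MDP S A) : IsMarkovKernel M.P := M.markov_P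

/-- `q ∈ M_b(S × A)`: bounded and measurable. -/
def IsBddMeas (q : S × A → ℝ) : Prop :=
  Measurable q ∧ ∃ C : ℝ, ∀ y, |q y| ≤ C

/-! ### Wasserstein metrics -/

/-- The `p`-Wasserstein distance of two measures on `ℝ`, as an infimum over couplings,
with values in `[0, ∞]`. -/
def wass (p : ℝ) (μ ν : Measure ℝ) : ℝ≥0∞ :=
  (⨅ (c : Measure (ℝ × ℝ)) (_ : c.fst = μ ∧ c.snd = ν),
    ∫⁻ z, edist z.1 z.2 ^ p ∂c) ^ (1 / p)

/-- `(∫ w_p(κ_y, κ'_y) ^ q dω(y)) ^ (1 / q)`, with values in `[0, ∞]`. -/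
def muWass {Y : Type*} [MeasurableSpace Y] (p q : ℝ) (ω : Measure Y) (κ κ' : Kernel Y ℝ) : ℝ≥0∞ :=
  (∫⁻ y, wass p (κ y) (κ' y) ^ q ∂ω) ^ (1 / q)

/-- Bounded `p`-th moments: `sup_y ∫ |z| ^ p dκ_y(z) < ∞`. -/
def HasBoundedMoments {Y : Type*} [MeasurableSpace Y] (p : ℝ) (κ : Kernel Y ℝ) : Prop :=
  (⨆ y, ∫⁻ z, ‖z‖ₑ ^ p ∂(κ y)) < ∞

/-- The mean function `(Q ζ)(y) = E_{Z ∼ ζ_y}[Z]`. -/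
def meanQ (ζ : Kernel (S × A) ℝ) (y : S × A) : ℝ := ∫ z, z ∂(ζ y)

/-! ### Trajectories and return distributions -/

/-- The state-action transition kernel of a policy `π`: from `(x, a)`, draw `x' ∼ P_{x,a}` and
then `a' ∼ π_{x'}`. -/
def step (M : MDP S A) (π : Kernel S A) : Kernel (S × A) (S × A) :=
  M.P ⊗ₖ π.prodMkLeft (S × A)

instance (M : MDP S A) (π : Kernel S A) [IsMarkovKernel π] : IsMarkovKernel (step M π) := by
  unfold step; infer_instance

/-- The law of the trajectory `(X_t, A_t)_{t ≥ 0}` generated by the policy `π`, conditionally on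
`(X_0, A_0) = (x, a)`, as a kernel in `(x, a)`. -/
def trajectory (M : MDP S A) (π : Kernel S A) [IsMarkovKernel π] :
    Kernel (S × A) (ℕ → S × A) :=
  (Kernel.traj (X := fun _ : ℕ => S × A)
    (fun n => (step M π).comap (fun h => h ⟨n, Finset.mem_Iic.2 le_rfl⟩)
      (measurable_pi_apply _)) 0).comap
    (fun y _ => y) (measurable_pi_lambda _ fun _ => measurable_id)

open Classical in
/-- The return distribution function `ζ^π_{x,a}`: the law of `∑_{t ≥ 0} γ^t r(X_t, A_t)` under `π`
given `(X_0, A_0) = (x, a)`. (The value `0` for a kernel that is not a policy, i.e. not Markov,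
is a convention.) -/
def returnDist (M : MDP S A) (π : Kernel S A) : Kernel (S × A) ℝ :=
  if _h : IsMarkovKernel π then
    (trajectory M π).map fun w => ∑' t : ℕ, M.γ ^ t * M.r (w t)
  else 0

/-- The function `x ↦ KL(π_x ‖ πref_x)`. -/
def klFn (π πref : Kernel S A) (x : S) : ℝ :=
  (InformationTheory.klDiv (π x) (πref x)).toReal

open Classical in
/-- The soft return distribution function of `π` at temperature `τ`: the law of
`r(X_0, A_0) + ∑_{t ≥ 1} γ^t (r(X_t, A_t) - τ KL(π_{X_t} ‖ πref_{X_t}))` under `π`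
given `(X_0, A_0) = (x, a)`. -/
def softReturnDist (M : MDP S A) (πref : Kernel S A) (τ : ℝ) (π : Kernel S A) :
    Kernel (S × A) ℝ :=
  if _h : IsMarkovKernel π then
    (trajectory M π).map fun w => M.r (w 0) +
      ∑' t : ℕ, M.γ ^ (t + 1) * (M.r (w (t + 1)) - τ * klFn π πref (w (t + 1)).1)
  else 0

/-- The action-value function `q^π`, the mean of `ζ^π`. -/
def qValue (M : MDP S A) (π : Kernel S A) : S × A → ℝ := meanQ (returnDist M π)

/-! ### Entropy-regularized reinforcement learning -/

/-- `(V_τ q)(x) = τ log ∫ exp(q(x, a) / τ) dπref_x(a)`. -/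
def softValue (πref : Kernel S A) (τ : ℝ) (q : S × A → ℝ) (x : S) : ℝ :=
  τ * Real.log (∫ a, Real.exp (q (x, a) / τ) ∂(πref x))

/-- The Boltzmann-Gibbs policy of `q` at temperature `τ`: its density with respect to `πref_x`
is `a ↦ exp((q(x, a) - (V_τ q)(x)) / τ)`. -/
def boltzmann (πref : Kernel S A) [IsSFiniteKernel πref] (τ : ℝ) (q : S × A → ℝ) : Kernel S A :=
  πref.withDensity fun x a => ENNReal.ofReal (Real.exp ((q (x, a) - softValue πref τ q x) / τ))

/-- The soft Bellman optimality operator. -/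
def softBellmanOpt (M : MDP S A) (πref : Kernel S A) (τ : ℝ) (q : S × A → ℝ) (y : S × A) : ℝ :=
  M.r y + M.γ * ∫ x', softValue πref τ q x' ∂(M.P y)

/-- `q*_τ`: the unique bounded measurable fixed point of the soft Bellman optimality operator. -/
def qSoftStar (M : MDP S A) (πref : Kernel S A) (τ : ℝ) : S × A → ℝ :=
  Classical.epsilon fun q => IsBddMeas q ∧ softBellmanOpt M πref τ q = q

/-- `π^{τ,*}`, the Boltzmann-Gibbs policy of `q*_τ`. -/
def piStar (M : MDP S A) (πref : Kernel S A) [IsSFiniteKernel πref] (τ : ℝ) : Kernel S A :=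
  boltzmann πref τ (qSoftStar M πref τ)

/-! ### Reference-optimality -/

/-- The Bellman reference-optimality operator. -/
def bellmanRef (M : MDP S A) (πref : Kernel S A) (q : S × A → ℝ) (y : S × A) : ℝ :=
  M.r y + M.γ * ∫ x', essSup (fun a' => q (x', a')) (πref x') ∂(M.P y)

/-- The reference-optimal action-value function: the unique bounded measurable fixed point of the
Bellman reference-optimality operator. -/
def qRefStar (M : MDP S A) (πref : Kernel S A) : S × A → ℝ :=
  Classical.epsilon fun q => IsBddMeas q ∧ bellmanRef M πref q = q

/-- `π` is a policy (a probability kernel) and `q^π ≥ q*_ref - ε` everywhere. -/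
def IsRefOptimal (M : MDP S A) (πref : Kernel S A) (ε : ℝ) (π : Kernel S A) : Prop :=
  IsMarkovKernel π ∧ ∀ y, qRefStar M πref y - ε ≤ qValue M π y

/-- The coverage assumption: some `pmin > 0` bounds from below, uniformly over `τ > 0` and `x`, the
`πref_x`-mass of the set of actions `a` with `q*_τ(x, a) = ess sup_{πref_x} q*_τ(x, ·)`. -/
def Coverage (M : MDP S A) (πref : Kernel S A) : Prop :=
  ∃ pmin : ℝ, 0 < pmin ∧ ENNReal.ofReal pmin ≤ ⨅ (τ : ℝ) (_ : 0 < τ) (x : S),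
    πref x {a | qSoftStar M πref τ (x, a) =
      essSup (fun a' => qSoftStar M πref τ (x, a')) (πref x)}

/-! ### Soft distributional Bellman operators -/

/-- The soft distributional Bellman operator: the new measure at `(x, a)` is the law of
`r(x, a) + γ Z' - γ τ KL(π_{X'} ‖ πref_{X'})`, where `(X', A')` is drawn from the state-action
transition kernel of `π` at `(x, a)` and `Z' ∼ ζ_{X',A'}`. -/
def softDistBellman (M : MDP S A) (πref : Kernel S A) (τ : ℝ) (π : Kernel S A)
    (ζ : Kernel (S × A) ℝ) : Kernel (S × A) ℝ :=
  (Kernel.id ×ₖ (step M π ⊗ₖ ζ.prodMkLeft (S × A))).map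
    fun w : (S × A) × (S × A) × ℝ =>
      M.r w.1 + M.γ * w.2.2 - M.γ * τ * klFn π πref w.2.1.1

/-- The soft distributional optimality operator: evaluate the Boltzmann-Gibbs policy of the mean
of `ζ`. -/
def softDistBellmanOpt (M : MDP S A) (πref : Kernel S A) [IsSFiniteKernel πref] (τ : ℝ)
    (ζ : Kernel (S × A) ℝ) : Kernel (S × A) ℝ :=
  softDistBellman M πref τ (boltzmann πref τ (meanQ ζ)) ζ

/-- The control iterates `ζ^0 = T ζ`, `ζ^{n+1} = T ζ^n`, with `T` the soft distributional
optimality operator. -/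
def controlIter (M : MDP S A) (πref : Kernel S A) [IsSFiniteKernel πref] (τ : ℝ)
    (ζ : Kernel (S × A) ℝ) : ℕ → Kernel (S × A) ℝ
  | 0 => softDistBellmanOpt M πref τ ζ
  | n + 1 => softDistBellmanOpt M πref τ (controlIter M πref τ ζ n)

end DERL

end

/-! Coverage forces the `πref`-essential supremum of the soft-optimal action value `q*_τ` to be at
most its soft value plus `k = τ log (1 / p_min)`, which tends to `0` with `τ`. Both the penalty
`τ KL` of the policy `π^{τ,*}` and the loss incurred by replacing the essential supremum with the
soft value are therefore at most `k` per step, hence at most `γ k / (1 - γ)` in total.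

Along control iterates the means obey the soft Bellman optimality recursion, so they converge
geometrically to `q*_τ`. Boltzmann policies of action values within `e` of each other share a common
part of mass `exp (-2 e / τ)`, on which a coupling can play the same action. Coupling one backup of
the iterates with one backup of the return distribution of `π^{τ,*}` thus gives costs with
`d (n + 1) ≤ γ (d n + a n)` and `a n → k`, whence `limsup d n ≤ γ k / (1 - γ)`.
-/

noncomputable section

namespace DERL

open Filter Topology UniformConvergence

universe u v

variable {S : Type u} {A : Type v} [MeasurableSpace S] [MeasurableSpace A]

section FixedPoint

theorem isClosed_setOf_isBddMeas :
    IsClosed {q : S × A →ᵤ ℝ | IsBddMeas (UniformFun.toFun q)} := by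
  refine IsSeqClosed.isClosed fun u q hu hlim => ?_
  have hunif := UniformFun.tendsto_iff_tendstoUniformly.1 hlim
  obtain ⟨n, hn⟩ := (Metric.tendstoUniformly_iff.1 hunif 1 one_pos).exists
  obtain ⟨C, hC⟩ := (hu n).2
  refine ⟨measurable_of_tendsto_metrizable (fun n => (hu n).1)
    (tendsto_pi_nhds.2 fun y => hunif.tendsto_at y), 1 + C, fun y => ?_⟩
  calc |UniformFun.toFun q y|
      ≤ |UniformFun.toFun q y - UniformFun.toFun (u n) y| + |UniformFun.toFun (u n) y| := by
        simpa using abs_add_le (UniformFun.toFun q y - UniformFun.toFun (u n) y)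
          (UniformFun.toFun (u n) y)
    _ ≤ 1 + C := add_le_add (hn y).le (hC y)

theorem exists_isBddMeas_fixedPoint {γ : ℝ} (hγ0 : 0 ≤ γ) (hγ1 : γ < 1)
    {F : (S × A → ℝ) → S × A → ℝ} (hF : ∀ q, IsBddMeas q → IsBddMeas (F q))
    (hlip : ∀ q q', IsBddMeas q → IsBddMeas q' → ∀ C, (∀ y, |q y - q' y| ≤ C) →
      ∀ y, |F q y - F q' y| ≤ γ * C) :
    ∃ q, IsBddMeas q ∧ F q = q := by
  lift γ to NNReal using hγ0
  let G : (S × A →ᵤ ℝ) → S × A →ᵤ ℝ := fun q => UniformFun.ofFun (F (UniformFun.toFun q))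
  let s : Set (S × A →ᵤ ℝ) := {q | IsBddMeas (UniformFun.toFun q)}
  have hmaps : MapsTo G s s := fun q hq => hF _ hq
  have hfinite : ∀ {q q' : S × A →ᵤ ℝ}, q ∈ s → q' ∈ s → edist q q' ≠ ∞ := by
    rintro q q' ⟨-, B, hB⟩ ⟨-, B', hB'⟩
    refine ne_top_of_le_ne_top ENNReal.ofReal_ne_top
      (UniformFun.edist_le (C := ENNReal.ofReal (B + B')) |>.2 fun y => ?_)
    rw [edist_dist]
    exact ENNReal.ofReal_le_ofReal ((abs_sub _ _).trans (add_le_add (hB y) (hB' y)))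
  have hcontract : ContractingWith γ (hmaps.restrict G s s) := by
    refine ⟨mod_cast hγ1, fun q q' => UniformFun.edist_le.2 fun y => ?_⟩
    have hdist := hlip _ _ q.2 q'.2 (edist q.1 q'.1).toReal (fun z => by
      rw [← Real.dist_eq, ← ENNReal.ofReal_le_iff_le_toReal (hfinite q.2 q'.2), ← edist_dist]
      exact UniformFun.edist_eval_le) y
    rw [edist_dist]
    refine (ENNReal.ofReal_le_ofReal hdist).trans_eq ?_
    rw [ENNReal.ofReal_mul γ.coe_nonneg, ENNReal.ofReal_toReal (hfinite q.2 q'.2),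
      ENNReal.ofReal_coe_nnreal, Subtype.edist_eq]
  have hzero : UniformFun.ofFun (0 : S × A → ℝ) ∈ s := ⟨measurable_const, 0, by simp⟩
  obtain ⟨q, hq, hfix, -⟩ := hcontract.exists_fixedPoint' isClosed_setOf_isBddMeas.isComplete
    hmaps hzero (hfinite hzero (hmaps hzero))
  exact ⟨UniformFun.toFun q, hq, congrArg UniformFun.toFun hfix⟩

theorem le_div_of_forall_le_mul_add {Y : Type*} {γ k : ℝ} (hγ : γ < 1) {d : Y → ℝ}
    (hd : BddAbove (range d)) (h : ∀ C, (∀ y, d y ≤ C) → ∀ y, d y ≤ γ * C + k) (y : Y) :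
    d y ≤ k / (1 - γ) := by
  have : Nonempty Y := ⟨y⟩
  have hsup : ⨆ y, d y ≤ γ * (⨆ y, d y) + k := ciSup_le (h _ (le_ciSup hd))
  refine (le_ciSup hd y).trans ?_
  rw [le_div_iff₀ (sub_pos.2 hγ)]
  linarith

end FixedPoint

section ValueOperator

/-- A monotone rule `V` turning action values `q` into state values `V q` that commutes with
additive constants up to an inequality: soft values, essential suprema and averages over a policy
are all of this kind, and each defines a Bellman operator. -/
structure IsValueOperator (V : (S × A → ℝ) → S → ℝ) : Prop where
  map_zero : V 0 = 0
  measurable {q : S × A → ℝ} : IsBddMeas q → Measurable (V q)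
  le_add {q q' : S × A → ℝ} {c : ℝ} : IsBddMeas q → IsBddMeas q' → (∀ y, q y ≤ q' y + c) →
    ∀ x, V q x ≤ V q' x + c

variable {V V' : (S × A → ℝ) → S → ℝ} {q q' : S × A → ℝ}

theorem IsValueOperator.abs_le (hV : IsValueOperator V) (hq : IsBddMeas q) {C : ℝ}
    (hC : ∀ y, |q y| ≤ C) (x : S) : |V q x| ≤ C := by
  have hzero : IsBddMeas (0 : S × A → ℝ) := ⟨measurable_const, 0, by simp⟩
  have hle := hV.le_add hq hzero (c := C) (fun y => by simpa using (_root_.abs_le.1 (hC y)).2) x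
  have hge := hV.le_add hzero hq (c := C)
    (fun y => by simpa using neg_le_iff_add_nonneg.1 (_root_.abs_le.1 (hC y)).1) x
  simp only [hV.map_zero, Pi.zero_apply] at hle hge
  exact _root_.abs_le.2 ⟨by linarith, by linarith⟩

theorem IsValueOperator.integrable (hV : IsValueOperator V) (hq : IsBddMeas q) (μ : Measure S)
    [IsFiniteMeasure μ] : Integrable (V q) μ := by
  obtain ⟨C, hC⟩ := hq.2
  exact .of_bound (hV.measurable hq).aestronglyMeasurable C (ae_of_all _ (hV.abs_le hq hC))

/-- The Bellman operator `q ↦ r + γ P (V q)` of a rule `V` for the value of a state. -/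
def bellman (M : MDP S A) (V : (S × A → ℝ) → S → ℝ) (q : S × A → ℝ) (y : S × A) : ℝ :=
  M.r y + M.γ * ∫ x', V q x' ∂(M.P y)

variable {M : MDP S A}

theorem isBddMeas_bellman (hV : IsValueOperator V) (hq : IsBddMeas q) :
    IsBddMeas (bellman M V q) := by
  obtain ⟨C, hC⟩ := hq.2
  obtain ⟨R, hR⟩ := M.bounded_r
  have hmeas : Measurable fun y => ∫ x', V q x' ∂(M.P y) :=
    (StronglyMeasurable.integral_kernel (hV.measurable hq).stronglyMeasurable).measurable
  refine ⟨M.measurable_r.add (hmeas.const_mul _), R + M.γ * C, fun y => ?_⟩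
  refine (abs_add_le _ _).trans (add_le_add (hR y) ?_)
  rw [abs_mul, abs_of_pos M.γ_pos]
  have hint : |∫ x', V q x' ∂(M.P y)| ≤ C := by
    simpa using norm_integral_le_of_norm_le_const (μ := M.P y) (f := V q)
      (ae_of_all _ (hV.abs_le hq hC))
  exact mul_le_mul_of_nonneg_left hint M.γ_pos.le

theorem bellman_le_add (hV : IsValueOperator V) (hV' : IsValueOperator V') (hq : IsBddMeas q)
    (hq' : IsBddMeas q') {c : ℝ} (h : ∀ x, V q x ≤ V' q' x + c) (y : S × A) :
    bellman M V q y ≤ bellman M V' q' y + M.γ * c := by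
  have hint : ∫ x', V q x' ∂(M.P y) ≤ ∫ x', V' q' x' ∂(M.P y) + c := by
    simpa [integral_add (hV'.integrable hq' _) (integrable_const c)] using
      integral_mono (hV.integrable hq _) ((hV'.integrable hq' (M.P y)).add (integrable_const c)) h
  have := mul_le_mul_of_nonneg_left hint M.γ_pos.le
  simp only [bellman]
  linarith

theorem bellman_abs_sub_le (hV : IsValueOperator V) (hq : IsBddMeas q) (hq' : IsBddMeas q')
    {C : ℝ} (h : ∀ y, |q y - q' y| ≤ C) (y : S × A) :
    |bellman M V q y - bellman M V q' y| ≤ M.γ * C := by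
  have hle : ∀ y, q y ≤ q' y + C := fun y => by linarith [(abs_sub_le_iff.1 (h y)).1]
  have hge : ∀ y, q' y ≤ q y + C := fun y => by linarith [(abs_sub_le_iff.1 (h y)).2]
  rw [abs_sub_le_iff, sub_le_iff_le_add', sub_le_iff_le_add']
  exact ⟨bellman_le_add hV hV hq hq' (hV.le_add hq hq' hle) y,
    bellman_le_add hV hV hq' hq (hV.le_add hq' hq hge) y⟩

theorem exists_bellman_fixedPoint (M : MDP S A) (hV : IsValueOperator V) :
    ∃ q, IsBddMeas q ∧ bellman M V q = q :=
  exists_isBddMeas_fixedPoint M.γ_pos.le M.γ_lt_one (fun _ hq => isBddMeas_bellman hV hq)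
    fun _ _ hq hq' _ h => bellman_abs_sub_le hV hq hq' h

theorem le_add_of_bellman_fixedPoint (hV : IsValueOperator V) (hV' : IsValueOperator V')
    (hq : IsBddMeas q) (hq' : IsBddMeas q') (hfix : bellman M V q = q)
    (hfix' : bellman M V' q' = q') {k : ℝ}
    (h : ∀ C, (∀ y, q y ≤ q' y + C) → ∀ x, V q x ≤ V' q' x + (C + k)) (y : S × A) :
    q y ≤ q' y + M.γ * k / (1 - M.γ) := by
  have hbdd : BddAbove (range fun y => q y - q' y) := by
    obtain ⟨B, hB⟩ := hq.2
    obtain ⟨B', hB'⟩ := hq'.2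
    exact ⟨B + B', forall_mem_range.2 fun y =>
      (le_abs_self _).trans ((abs_sub _ _).trans (add_le_add (hB y) (hB' y)))⟩
  refine sub_le_iff_le_add'.1 (le_div_of_forall_le_mul_add M.γ_lt_one hbdd (fun C hC y => ?_) y)
  have := bellman_le_add (M := M) hV hV' hq hq' (h C fun y => sub_le_iff_le_add'.1 (hC y)) y
  rw [hfix, hfix'] at this
  linarith

end ValueOperator

section Values

variable {q q' : S × A → ℝ}

theorem IsBddMeas.measurable_section (hq : IsBddMeas q) (x : S) : Measurable fun a => q (x, a) :=
  hq.1.comp measurable_prodMk_left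

theorem IsBddMeas.integrable_section (hq : IsBddMeas q) (x : S) (μ : Measure A)
    [IsFiniteMeasure μ] : Integrable (fun a => q (x, a)) μ := by
  obtain ⟨C, hC⟩ := hq.2
  exact .of_bound (hq.measurable_section x).aestronglyMeasurable C (ae_of_all _ fun a => hC (x, a))

theorem isValueOperator_integral (π : Kernel S A) [IsMarkovKernel π] :
    IsValueOperator fun q x => ∫ a, q (x, a) ∂(π x) where
  map_zero := by ext; simp
  measurable hq := (StronglyMeasurable.integral_kernel_prod_right' (κ := π)
    hq.1.stronglyMeasurable).measurable
  le_add {q q' c} hq hq' h x := by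
    simpa [integral_add (hq'.integrable_section x (π x)) (integrable_const c)] using
      integral_mono (hq.integrable_section x (π x))
        ((hq'.integrable_section x (π x)).add (integrable_const c)) fun a => h (x, a)

theorem ae_le_essSup_of_abs_le {Ω : Type*} [MeasurableSpace Ω] {μ : Measure Ω}
    {f : Ω → ℝ} {B : ℝ} (hB : ∀ z, |f z| ≤ B) : ∀ᵐ z ∂μ, f z ≤ essSup f μ :=
  ae_le_essSup (hf := isBoundedUnder_of ⟨B, fun z => (abs_le.1 (hB z)).2⟩)

theorem essSup_le_iff_ae_le {Ω : Type*} [MeasurableSpace Ω] {μ : Measure Ω} [NeZero μ]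
    {f : Ω → ℝ} {B C : ℝ} (hB : ∀ z, |f z| ≤ B) : essSup f μ ≤ C ↔ ∀ᵐ z ∂μ, f z ≤ C :=
  ⟨fun h => (ae_le_essSup_of_abs_le hB).mono fun _ hz => hz.trans h, fun h =>
    essSup_le_of_ae_le _ h (isCoboundedUnder_le_of_le _ (x := -B) fun z => (abs_le.1 (hB z)).1)⟩

theorem isValueOperator_essSup (π : Kernel S A) [IsMarkovKernel π] :
    IsValueOperator fun q x => essSup (fun a => q (x, a)) (π x) where
  map_zero := by ext x; exact essSup_const _ (NeZero.ne (π x))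
  measurable {q} hq := by
    obtain ⟨C, hC⟩ := hq.2
    refine measurable_of_Iic fun c => ?_
    have hpreimage : (fun x => essSup (fun a => q (x, a)) (π x)) ⁻¹' Iic c
        = {x | π x (Prod.mk x ⁻¹' {y | c < q y}) = 0} := by
      ext x
      simp only [mem_preimage, mem_Iic, mem_ofPred_eq]
      rw [essSup_le_iff_ae_le (μ := π x) fun a => hC (x, a), ae_iff]
      simp
    rw [hpreimage]
    exact Kernel.measurable_kernel_prodMk_left (κ := π)
      (measurableSet_lt measurable_const hq.1) (measurableSet_singleton 0)
  le_add {q q' c} hq hq' h x := by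
    obtain ⟨B, hB⟩ := hq.2
    obtain ⟨B', hB'⟩ := hq'.2
    rw [essSup_le_iff_ae_le (μ := π x) fun a => hB (x, a)]
    filter_upwards [ae_le_essSup_of_abs_le (μ := π x) fun a => hB' (x, a)] with a ha
    linarith [h (x, a)]

variable {πref : Kernel S A} [IsMarkovKernel πref] {τ : ℝ}

theorem integrable_exp_div (hq : IsBddMeas q) (hτ : 0 < τ) (x : S) (μ : Measure A)
    [IsFiniteMeasure μ] : Integrable (fun a => Real.exp (q (x, a) / τ)) μ := by
  obtain ⟨C, hC⟩ := hq.2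
  refine .of_bound ((hq.measurable_section x).div_const τ).exp.aestronglyMeasurable
    (Real.exp (C / τ)) (ae_of_all _ fun a => ?_)
  rw [Real.norm_of_nonneg (Real.exp_pos _).le]
  gcongr
  exact (le_abs_self _).trans (hC _)

theorem integral_exp_div_pos (hq : IsBddMeas q) (hτ : 0 < τ) (x : S) :
    0 < ∫ a, Real.exp (q (x, a) / τ) ∂(πref x) :=
  integral_exp_pos (integrable_exp_div hq hτ x _)

theorem exp_softValue_div (hq : IsBddMeas q) (hτ : 0 < τ) (x : S) :
    Real.exp (softValue πref τ q x / τ) = ∫ a, Real.exp (q (x, a) / τ) ∂(πref x) := by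
  rw [softValue, mul_div_cancel_left₀ _ hτ.ne', Real.exp_log (integral_exp_div_pos hq hτ x)]

theorem isValueOperator_softValue (πref : Kernel S A) [IsMarkovKernel πref] (hτ : 0 < τ) :
    IsValueOperator (softValue πref τ) where
  map_zero := by ext; simp [softValue]
  measurable {q} hq := (Real.measurable_log.comp
    (StronglyMeasurable.integral_kernel_prod_right' (κ := πref)
      (f := fun y : S × A => Real.exp (q y / τ))
      (hq.1.div_const τ).exp.stronglyMeasurable).measurable).const_mul τ
  le_add {q q' c} hq hq' h x := by
    have hexp : Real.exp (softValue πref τ q x / τ)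
        ≤ Real.exp ((softValue πref τ q' x + c) / τ) := by
      rw [add_div, Real.exp_add, exp_softValue_div hq hτ, exp_softValue_div hq' hτ,
        ← integral_mul_const]
      refine integral_mono (integrable_exp_div hq hτ x _)
        ((integrable_exp_div hq' hτ x _).mul_const _) fun a => ?_
      rw [← Real.exp_add, ← add_div]
      gcongr
      exact h _
    exact (div_le_div_iff_of_pos_right hτ).1 (Real.exp_le_exp.1 hexp)

theorem qSoftStar_spec (M : MDP S A) (πref : Kernel S A) [IsMarkovKernel πref] (hτ : 0 < τ) :
    IsBddMeas (qSoftStar M πref τ) ∧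
      bellman M (softValue πref τ) (qSoftStar M πref τ) = qSoftStar M πref τ :=
  Classical.epsilon_spec (exists_bellman_fixedPoint M (isValueOperator_softValue πref hτ))

theorem qRefStar_spec (M : MDP S A) (πref : Kernel S A) [IsMarkovKernel πref] :
    IsBddMeas (qRefStar M πref) ∧
      bellman M (fun q x => essSup (fun a => q (x, a)) (πref x)) (qRefStar M πref)
        = qRefStar M πref :=
  Classical.epsilon_spec (exists_bellman_fixedPoint M (isValueOperator_essSup πref))

theorem essSup_le_softValue_add (hq : IsBddMeas q) (hτ : 0 < τ) (x : S) {c : ℝ} (hc : 0 < c)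
    (h : ENNReal.ofReal c ≤ πref x {a | q (x, a) = essSup (fun a' => q (x, a')) (πref x)}) :
    essSup (fun a => q (x, a)) (πref x) ≤ softValue πref τ q x + τ * Real.log (1 / c) := by
  set m := essSup (fun a => q (x, a)) (πref x)
  set E := {a | q (x, a) = m}
  have hE : MeasurableSet E := hq.measurable_section x (measurableSet_singleton m)
  have hcE : c ≤ (πref x).real E := (ENNReal.ofReal_le_iff_le_toReal (measure_ne_top _ _)).1 h
  have hexp : c * Real.exp (m / τ) ≤ Real.exp (softValue πref τ q x / τ) := by
    calc c * Real.exp (m / τ) ≤ (πref x).real E * Real.exp (m / τ) := by gcongr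
      _ = ∫ a in E, Real.exp (q (x, a) / τ) ∂(πref x) := by
        rw [setIntegral_congr_fun (g := fun _ => Real.exp (m / τ)) hE
          fun a (ha : q (x, a) = m) => by rw [ha]]
        simp
      _ ≤ ∫ a, Real.exp (q (x, a) / τ) ∂(πref x) :=
        setIntegral_le_integral (integrable_exp_div hq hτ x _)
          (ae_of_all _ fun a => (Real.exp_pos _).le)
      _ = Real.exp (softValue πref τ q x / τ) := (exp_softValue_div hq hτ x).symm
  have hlog : Real.log c + m / τ ≤ softValue πref τ q x / τ := by
    simpa [Real.log_mul hc.ne' (Real.exp_pos _).ne'] using Real.log_le_log (by positivity) hexp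
  rw [le_div_iff₀ hτ, add_mul, div_mul_cancel₀ _ hτ.ne'] at hlog
  rw [one_div, Real.log_inv]
  linarith

end Values

section Boltzmann

variable {πref : Kernel S A} [IsMarkovKernel πref] {τ : ℝ} {q q' : S × A → ℝ}

theorem measurable_boltzmann_density (hq : IsBddMeas q) (hτ : 0 < τ) :
    Measurable (uncurry fun x a =>
      ENNReal.ofReal (Real.exp ((q (x, a) - softValue πref τ q x) / τ))) :=
  ((hq.1.sub (((isValueOperator_softValue πref hτ).measurable hq).comp
    measurable_fst)).div_const τ).exp.ennreal_ofReal

theorem boltzmann_apply (hq : IsBddMeas q) (hτ : 0 < τ) (x : S) :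
    boltzmann πref τ q x = (πref x).tilted fun a => q (x, a) / τ := by
  simp_rw [boltzmann, Kernel.withDensity_apply _ (measurable_boltzmann_density hq hτ),
    Measure.tilted, sub_div, Real.exp_sub, exp_softValue_div hq hτ]

theorem isMarkovKernel_boltzmann (hq : IsBddMeas q) (hτ : 0 < τ) :
    IsMarkovKernel (boltzmann πref τ q) :=
  ⟨fun x => boltzmann_apply (πref := πref) hq hτ x ▸
    isProbabilityMeasure_tilted (integrable_exp_div hq hτ x _)⟩

theorem boltzmann_absolutelyContinuous (hq : IsBddMeas q) (hτ : 0 < τ) (x : S) :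
    boltzmann πref τ q x ≪ πref x :=
  boltzmann_apply (πref := πref) hq hτ x ▸ tilted_absolutelyContinuous _ _

theorem llr_boltzmann (hq : IsBddMeas q) (hτ : 0 < τ) (x : S) :
    llr (boltzmann πref τ q x) (πref x) =ᵐ[πref x]
      fun a => (q (x, a) - softValue πref τ q x) / τ := by
  have hlog := log_rnDeriv_tilted_left_self (integrable_exp_div (τ := τ) hq hτ x (πref x))
  rw [← boltzmann_apply (πref := πref) hq hτ] at hlog
  filter_upwards [hlog] with a ha
  rw [llr, ha, ← exp_softValue_div hq hτ, Real.log_exp, sub_div]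

theorem mul_klFn_boltzmann (hq : IsBddMeas q) (hτ : 0 < τ) (x : S) :
    τ * klFn (boltzmann πref τ q) πref x
      = ∫ a, q (x, a) ∂(boltzmann πref τ q x) - softValue πref τ q x := by
  have := isMarkovKernel_boltzmann (πref := πref) hq hτ
  have hac := boltzmann_absolutelyContinuous (πref := πref) hq hτ x
  rw [klFn, InformationTheory.toReal_klDiv_of_measure_eq hac (by simp),
    integral_congr_ae (hac.ae_le (llr_boltzmann hq hτ x)), integral_div, mul_div_cancel₀ _ hτ.ne',
    integral_sub (hq.integrable_section x _) (integrable_const _)]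
  simp

theorem measurable_klFn_boltzmann (hq : IsBddMeas q) (hτ : 0 < τ) :
    Measurable (klFn (boltzmann πref τ q) πref) := by
  have := isMarkovKernel_boltzmann (πref := πref) hq hτ
  have hkl : klFn (boltzmann πref τ q) πref
      = fun x => (∫ a, q (x, a) ∂(boltzmann πref τ q x) - softValue πref τ q x) / τ :=
    funext fun x => by rw [← mul_klFn_boltzmann hq hτ, mul_div_cancel_left₀ _ hτ.ne']
  rw [hkl]
  exact (((isValueOperator_integral (boltzmann πref τ q)).measurable hq).sub
    ((isValueOperator_softValue πref hτ).measurable hq)).div_const τ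

theorem mul_klFn_boltzmann_le (hq : IsBddMeas q) (hτ : 0 < τ) (x : S) {k : ℝ}
    (h : essSup (fun a => q (x, a)) (πref x) ≤ softValue πref τ q x + k) :
    τ * klFn (boltzmann πref τ q) πref x ≤ k := by
  have := isMarkovKernel_boltzmann (πref := πref) hq hτ
  obtain ⟨C, hC⟩ := hq.2
  have hle : ∫ a, q (x, a) ∂(boltzmann πref τ q x) ≤ softValue πref τ q x + k := by
    have hae := (boltzmann_absolutelyContinuous (πref := πref) hq hτ x).ae_le
      ((essSup_le_iff_ae_le fun a => hC (x, a)).1 h)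
    simpa using integral_mono_ae (hq.integrable_section x _) (integrable_const _) hae
  rw [mul_klFn_boltzmann hq hτ]
  linarith

theorem exists_withDensity_eq_add {κ : Kernel S A} [IsSFiniteKernel κ] {f f' : S → A → ℝ≥0∞}
    (hf : Measurable (uncurry f)) (hf' : Measurable (uncurry f')) (hf_top : ∀ x a, f x a ≠ ∞)
    {s : ℝ≥0∞} (h : ∀ x a, s * f' x a ≤ f x a) :
    ∃ Q R : Kernel S A, IsSFiniteKernel Q ∧ IsSFiniteKernel R ∧ κ.withDensity f = Q + R ∧
      ∀ x, Q x = s • κ.withDensity f' x := by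
  have hsf' : Measurable (uncurry fun x a => s * f' x a) := hf'.const_mul s
  refine ⟨κ.withDensity fun x a => s * f' x a, κ.withDensity fun x a => f x a - s * f' x a,
    Kernel.IsSFiniteKernel.withDensity κ fun x a => ne_top_of_le_ne_top (hf_top x a) (h x a),
    Kernel.IsSFiniteKernel.withDensity κ fun x a => ne_top_of_le_ne_top (hf_top x a) tsub_le_self,
    ?_, fun x => ?_⟩
  · rw [add_comm, Kernel.withDensity_sub_add_cancel hf hsf' fun x => ae_of_all _ (h x)]
  · rw [Kernel.withDensity_apply _ hsf', Kernel.withDensity_apply _ hf',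
      ← withDensity_smul (f := f' x) s (hf'.comp measurable_prodMk_left)]
    rfl

theorem exists_boltzmann_eq_add (hq : IsBddMeas q) (hq' : IsBddMeas q') (hτ : 0 < τ) {e : ℝ}
    (he : ∀ y, |q y - q' y| ≤ e) :
    ∃ Q R : Kernel S A, IsSFiniteKernel Q ∧ IsSFiniteKernel R ∧ boltzmann πref τ q = Q + R ∧
      ∀ x, Q x = ENNReal.ofReal (Real.exp (-(2 * e / τ))) • boltzmann πref τ q' x := by
  refine exists_withDensity_eq_add (measurable_boltzmann_density hq hτ)
    (measurable_boltzmann_density hq' hτ) (fun _ _ => ENNReal.ofReal_ne_top) fun x a => ?_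
  rw [← ENNReal.ofReal_mul (Real.exp_pos _).le, ← Real.exp_add, ← neg_div, ← add_div]
  have hsoft := (isValueOperator_softValue πref hτ).le_add hq hq' (c := e)
    (fun y => by linarith [(abs_sub_le_iff.1 (he y)).1]) x
  gcongr
  linarith [(abs_sub_le_iff.1 (he (x, a))).2]

end Boltzmann

section MarkovChain

open Preorder

variable {X : Type*}

/-- The finite history obtained by appending one more state. -/
def snocHistory (n : ℕ) (h : (Finset.Iic n → X) × X) (i : Finset.Iic (n + 1)) : X :=
  if hi : i.1 ≤ n then h.1 ⟨i.1, Finset.mem_Iic.2 hi⟩ else h.2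

/-- The trajectory obtained by deleting the first state. -/
def shift (w : ℕ → X) (n : ℕ) : X := w (n + 1)

theorem frestrictLe_succ_eq_snocHistory (n : ℕ) (w : ℕ → X) :
    frestrictLe (π := fun _ : ℕ => X) (n + 1) w
      = snocHistory n (frestrictLe (π := fun _ : ℕ => X) n w, w (n + 1)) := by
  ext ⟨i, hi⟩
  by_cases h : i ≤ n
  · simp [snocHistory, h]
  · obtain rfl : i = n + 1 := le_antisymm (Finset.mem_Iic.1 hi) (not_le.1 h)
    simp [snocHistory]

variable [MeasurableSpace X]

theorem measurable_snocHistory (n : ℕ) : Measurable (snocHistory (X := X) n) := by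
  refine measurable_pi_lambda _ fun i => ?_
  unfold snocHistory
  split_ifs <;> fun_prop

theorem measurable_shift : Measurable (shift (X := X)) := by
  unfold shift; fun_prop

/-- The transition kernel `K`, as a kernel in the history up to time `n`. -/
def histKernel (K : Kernel X X) (n : ℕ) : Kernel (Finset.Iic n → X) X :=
  K.comap (fun h => h ⟨n, Finset.mem_Iic.2 le_rfl⟩) (measurable_pi_apply _)

instance (K : Kernel X X) [IsMarkovKernel K] (n : ℕ) : IsMarkovKernel (histKernel K n) := by
  unfold histKernel; infer_instance

/-- `μ` is the law of a Markov chain with transition kernel `K`: given the states up to time `n`,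
the next one is drawn from `K` at the `n`-th. The initial law is arbitrary. -/
def IsMarkovChain (K : Kernel X X) (μ : Measure (ℕ → X)) : Prop :=
  ∀ n, ∀ F : (Finset.Iic n → X) × X → ℝ≥0∞, Measurable F →
    ∫⁻ w, F (frestrictLe (π := fun _ : ℕ => X) n w, w (n + 1)) ∂μ
      = ∫⁻ w, ∫⁻ x, F (frestrictLe (π := fun _ : ℕ => X) n w, x) ∂(K (w n)) ∂μ

variable {K : Kernel X X} {μ ν : Measure (ℕ → X)}

theorem measurable_lintegral_histKernel [IsSFiniteKernel K] {n : ℕ}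
    {F : (Finset.Iic n → X) × X → ℝ≥0∞} (hF : Measurable F) :
    Measurable fun h : Finset.Iic n → X =>
      ∫⁻ x, F (h, x) ∂(K (h ⟨n, Finset.mem_Iic.2 le_rfl⟩)) := by
  have : IsSFiniteKernel (histKernel K n) := by unfold histKernel; infer_instance
  exact hF.lintegral_kernel_prod_right' (κ := histKernel K n)

theorem measurable_lintegral_next [IsSFiniteKernel K] {n : ℕ}
    {F : (Finset.Iic n → X) × X → ℝ≥0∞} (hF : Measurable F) :
    Measurable fun w : ℕ → X =>
      ∫⁻ x, F (frestrictLe (π := fun _ : ℕ => X) n w, x) ∂(K (w n)) :=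
  (measurable_lintegral_histKernel (K := K) hF).comp
    (measurable_frestrictLe (X := fun _ : ℕ => X) n)

theorem IsMarkovChain.map_eval_one (hμ : IsMarkovChain K μ) :
    μ.map (fun w => w 1) = (μ.map fun w => w 0).bind K := by
  refine Measure.ext_of_lintegral _ fun f hf => ?_
  rw [Measure.lintegral_bind K.aemeasurable hf.aemeasurable,
    lintegral_map hf (measurable_pi_apply 1), lintegral_map hf.lintegral_kernel
      (measurable_pi_apply 0)]
  exact hμ 0 (fun z => f z.2) (hf.comp measurable_snd)

theorem IsMarkovChain.map_shift [IsSFiniteKernel K] (hμ : IsMarkovChain K μ) :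
    IsMarkovChain K (μ.map shift) := by
  intro n F hF
  have htail : Measurable fun (h : Finset.Iic (n + 1) → X) (i : Finset.Iic n) =>
      h ⟨i.1 + 1, Finset.mem_Iic.2 (Nat.succ_le_succ (Finset.mem_Iic.1 i.2))⟩ := by fun_prop
  rw [lintegral_map (by fun_prop) measurable_shift,
    lintegral_map (measurable_lintegral_next hF) measurable_shift]
  exact hμ (n + 1) _ (hF.comp ((htail.comp measurable_fst).prodMk measurable_snd))

theorem IsMarkovChain.map_frestrictLe_eq [IsSFiniteKernel K] (hμ : IsMarkovChain K μ)
    (hν : IsMarkovChain K ν) (h : μ.map (fun w => w 0) = ν.map fun w => w 0) (n : ℕ) :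
    μ.map (frestrictLe (π := fun _ : ℕ => X) n) = ν.map (frestrictLe (π := fun _ : ℕ => X) n) := by
  induction n with
  | zero =>
    have hconst : Measurable fun (x : X) (_ : Finset.Iic 0) => x := by fun_prop
    have hzero : frestrictLe (π := fun _ : ℕ => X) 0
        = (fun (x : X) (_ : Finset.Iic 0) => x) ∘ fun w : ℕ → X => w 0 := by
      ext w i
      simp [Nat.le_zero.1 (Finset.mem_Iic.1 i.2)]
    rw [hzero, ← Measure.map_map hconst (by fun_prop), h, Measure.map_map hconst (by fun_prop)]
  | succ n ih =>
    refine Measure.ext_of_lintegral _ fun f hf => ?_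
    have hF : Measurable fun z => f (snocHistory n z) := hf.comp (measurable_snocHistory n)
    rw [lintegral_map hf (measurable_frestrictLe _), lintegral_map hf (measurable_frestrictLe _)]
    simp_rw [frestrictLe_succ_eq_snocHistory]
    rw [hμ n (fun z => f (snocHistory n z)) hF, hν n (fun z => f (snocHistory n z)) hF]
    have hG := measurable_lintegral_histKernel (K := K) hF
    have hmap := lintegral_map hG (measurable_frestrictLe (X := fun _ : ℕ => X) n) (μ := μ)
    rw [ih, lintegral_map hG (measurable_frestrictLe n)] at hmap
    exact hmap.symm

theorem IsMarkovChain.ext [IsSFiniteKernel K] [IsFiniteMeasure ν]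
    (hμ : IsMarkovChain K μ) (hν : IsMarkovChain K ν)
    (h : μ.map (fun w => w 0) = ν.map fun w => w 0) : μ = ν := by
  have hproj : IsProjectiveMeasureFamily fun I : Finset ℕ => ν.map fun w : ℕ → X => I.restrict w :=
    isProjectiveMeasureFamily_map_restrict fun t => (measurable_pi_apply t).aemeasurable
  exact ((isProjectiveLimit_nat_iff hproj μ).2 fun n => hμ.map_frestrictLe_eq hν h n).unique
    fun _ => rfl

theorem isMarkovChain_bind {Y : Type*} [MeasurableSpace Y] [IsSFiniteKernel K]
    {η : Kernel Y (ℕ → X)} (hη : ∀ y, IsMarkovChain K (η y)) (m : Measure Y) :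
    IsMarkovChain K (m.bind η) := by
  intro n F hF
  rw [Measure.lintegral_bind η.aemeasurable (by fun_prop),
    Measure.lintegral_bind η.aemeasurable (measurable_lintegral_next hF).aemeasurable]
  exact lintegral_congr fun y => hη y n F hF

variable (K) [IsMarkovKernel K]

/-- The law of the Markov chain with transition kernel `K`, as a kernel in its starting point. -/
def chain : Kernel X (ℕ → X) :=
  (Kernel.traj (X := fun _ : ℕ => X) (histKernel K) 0).comap
    (fun y _ => y) (measurable_pi_lambda _ fun _ => measurable_id)

instance : IsMarkovKernel (chain K) := by unfold chain; infer_instance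

theorem isMarkovChain_chain (y : X) : IsMarkovChain K (chain K y) := by
  intro n F hF
  have h := Kernel.partialTraj_compProd_eq_map_traj (X := fun _ : ℕ => X)
    (κ := histKernel K) (Nat.zero_le n) (x₀ := fun _ => y)
  have hnext : Measurable fun w : ℕ → X => (frestrictLe (π := fun _ : ℕ => X) n w, w (n + 1)) :=
    (measurable_frestrictLe n).prodMk (measurable_pi_apply _)
  have hint := lintegral_map (μ := chain K y) hF hnext
  rw [← Kernel.traj_map_frestrictLe_apply] at h
  rw [← hint]
  refine (congrArg (fun μ => ∫⁻ z, F z ∂μ) h.symm).trans ?_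
  rw [Measure.lintegral_compProd hF, lintegral_map hF.lintegral_kernel_prod_right'
    (measurable_frestrictLe n)]
  rfl

theorem chain_map_eval_zero (y : X) : (chain K y).map (fun w => w 0) = Measure.dirac y := by
  have hmap := Kernel.traj_map_frestrictLe_apply (X := fun _ : ℕ => X)
    (κ := histKernel K) 0 0 (fun _ => y)
  have heval : Measurable fun v : Finset.Iic 0 → X => v ⟨0, Finset.mem_Iic.2 le_rfl⟩ :=
    measurable_pi_apply _
  rw [Kernel.partialTraj_self, Kernel.id_apply] at hmap
  have hzero := congrArg (Measure.map fun v => v ⟨0, Finset.mem_Iic.2 le_rfl⟩) hmap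
  rwa [Measure.map_map heval (measurable_frestrictLe 0), Measure.map_dirac' heval] at hzero

theorem map_shift_chain : (chain K).map shift = chain K ∘ₖ K := by
  ext1 y
  rw [Kernel.map_apply _ measurable_shift, Kernel.comp_apply]
  refine (isMarkovChain_chain K y).map_shift.ext (isMarkovChain_bind (isMarkovChain_chain K) _) ?_
  rw [Measure.map_map (by fun_prop) measurable_shift]
  change (chain K y).map (fun w => w 1) = _
  rw [(isMarkovChain_chain K y).map_eval_one, chain_map_eval_zero, Measure.dirac_bind K.measurable]
  refine Measure.ext_of_lintegral _ fun f hf => ?_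
  have hf0 : Measurable fun w : ℕ → X => f (w 0) := hf.comp (measurable_pi_apply 0)
  rw [lintegral_map hf (measurable_pi_apply 0),
    Measure.lintegral_bind (chain K).aemeasurable hf0.aemeasurable]
  refine lintegral_congr fun y' => ?_
  rw [← lintegral_map hf (measurable_pi_apply 0), chain_map_eval_zero, lintegral_dirac' _ hf]

end MarkovChain

section Backup

variable {X Y Z W : Type*} [MeasurableSpace X] [MeasurableSpace Y] [MeasurableSpace Z]
  [MeasurableSpace W]

/-- The kernel sending `y` to the law of `g (y, x, z)`, where `x ∼ η_y` and `z ∼ α_x`. -/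
def backup (η : Kernel Y X) (α : Kernel X Z) (g : Y × X × Z → W) : Kernel Y W :=
  (Kernel.id ×ₖ (η ⊗ₖ α.prodMkLeft Y)).map g

variable {η : Kernel Y X} {α : Kernel X Z} {g : Y × X × Z → W}

theorem isMarkovKernel_backup [IsMarkovKernel η] [IsMarkovKernel α] (hg : Measurable g) :
    IsMarkovKernel (backup η α g) :=
  Kernel.IsMarkovKernel.map _ hg

variable [IsSFiniteKernel η] [IsSFiniteKernel α]

theorem backup_apply (hg : Measurable g) (y : Y) :
    backup η α g y = (η y ⊗ₘ α).map fun w => g (y, w) := by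
  rw [backup, Kernel.map_apply _ hg, Kernel.prod_apply, Kernel.id_apply,
    Kernel.compProd_apply_eq_compProd_sectR, Kernel.sectR_prodMkLeft, Measure.dirac_prod,
    Measure.map_map hg measurable_prodMk_left]
  rfl

theorem lintegral_backup (hg : Measurable g) {f : W → ℝ≥0∞} (hf : Measurable f) (y : Y) :
    ∫⁻ w, f w ∂(backup η α g y) = ∫⁻ x, ∫⁻ z, f (g (y, x, z)) ∂(α x) ∂(η y) := by
  have hgy : Measurable fun w : X × Z => g (y, w) := hg.comp measurable_prodMk_left
  rw [backup_apply hg, lintegral_map hf hgy]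
  exact Measure.lintegral_compProd (hf.comp hgy)

theorem integral_backup {g : Y × X × Z → ℝ} (hg : Measurable g) {y : Y}
    (hint : Integrable (fun z => z) (backup η α g y)) :
    ∫ w, w ∂(backup η α g y) = ∫ x, ∫ z, g (y, x, z) ∂(α x) ∂(η y) := by
  have hgy : Measurable fun w : X × Z => g (y, w) := hg.comp measurable_prodMk_left
  rw [backup_apply hg] at hint ⊢
  rw [integral_map hgy.aemeasurable (f := fun z => z) aestronglyMeasurable_id]
  exact Measure.integral_compProd
    ((integrable_map_measure aestronglyMeasurable_id hgy.aemeasurable).1 hint)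

end Backup

section ActionAverage

variable {Z : Type*} [MeasurableSpace Z]

/-- The kernel sending a state `x` to the law of a draw from `κ_{x,a}`, where `a ∼ π_x`. -/
def actionAverage (π : Kernel S A) (κ : Kernel (S × A) Z) : Kernel S Z :=
  (π ⊗ₖ κ).snd

variable {π : Kernel S A} [IsSFiniteKernel π] {κ : Kernel (S × A) Z}

instance [IsMarkovKernel π] [IsMarkovKernel κ] : IsMarkovKernel (actionAverage π κ) := by
  unfold actionAverage; infer_instance

instance : IsSFiniteKernel (actionAverage π κ) := by
  unfold actionAverage; infer_instance

theorem lintegral_actionAverage [IsSFiniteKernel κ] {f : Z → ℝ≥0∞} (hf : Measurable f) (x : S) :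
    ∫⁻ z, f z ∂(actionAverage π κ x) = ∫⁻ a, ∫⁻ z, f z ∂(κ (x, a)) ∂(π x) := by
  rw [actionAverage, Kernel.lintegral_snd _ _ hf]
  exact Kernel.lintegral_compProd _ _ _ (hf.comp measurable_snd)

theorem integral_actionAverage [IsSFiniteKernel κ] {f : Z → ℝ} {x : S}
    (hint : Integrable f (actionAverage π κ x)) :
    ∫ z, f z ∂(actionAverage π κ x) = ∫ a, ∫ z, f z ∂(κ (x, a)) ∂(π x) := by
  rw [actionAverage, Kernel.snd_apply] at hint ⊢
  rw [integral_map measurable_snd.aemeasurable hint.aestronglyMeasurable]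
  exact ProbabilityTheory.integral_compProd
    ((integrable_map_measure hint.aestronglyMeasurable measurable_snd.aemeasurable).1 hint)

theorem backup_step {W : Type*} [MeasurableSpace W] (M : MDP S A) [IsMarkovKernel π]
    [IsMarkovKernel κ] {g : (S × A) × S × Z → W} (hg : Measurable g) :
    backup (step M π) κ (fun w => g (w.1, w.2.1.1, w.2.2)) = backup M.P (actionAverage π κ) g := by
  refine Kernel.ext fun y => Measure.ext_of_lintegral _ fun f hf => ?_
  have hg' : Measurable fun w : (S × A) × (S × A) × Z => g (w.1, w.2.1.1, w.2.2) := by fun_prop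
  have hfg : Measurable fun w : (S × A) × Z => f (g (y, w.1.1, w.2)) := by fun_prop
  rw [lintegral_backup hg' hf, lintegral_backup hg hf, step,
    Kernel.lintegral_compProd _ _ _ hfg.lintegral_kernel_prod_right']
  refine lintegral_congr fun x => ?_
  rw [lintegral_actionAverage (f := fun z => f (g (y, x, z))) (by fun_prop)]
  rfl

end ActionAverage

section Moments

variable {X Y : Type*} [MeasurableSpace X] [MeasurableSpace Y] {p : ℝ} {κ : Kernel Y ℝ}

theorem hasBoundedMoments_of_ae_abs_le [IsMarkovKernel κ] (hp : 0 ≤ p) {C : ℝ}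
    (h : ∀ y, ∀ᵐ z ∂(κ y), |z| ≤ C) : HasBoundedMoments p κ := by
  refine (iSup_le fun y => ?_).trans_lt
    (ENNReal.rpow_lt_top_of_nonneg hp (ENNReal.ofReal_ne_top (r := C)))
  calc ∫⁻ z, ‖z‖ₑ ^ p ∂(κ y) ≤ ∫⁻ _, ENNReal.ofReal C ^ p ∂(κ y) := by
        refine lintegral_mono_ae ((h y).mono fun z hz => ?_)
        gcongr
        rw [← ofReal_norm]
        exact ENNReal.ofReal_le_ofReal hz
    _ = ENNReal.ofReal C ^ p := by simp

theorem HasBoundedMoments.exists_lintegral_enorm_le [IsMarkovKernel κ] (hp : 1 ≤ p)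
    (hκ : HasBoundedMoments p κ) : ∃ C : ℝ, 0 ≤ C ∧ ∀ y, ∫⁻ z, ‖z‖ₑ ∂(κ y) ≤ ENNReal.ofReal C := by
  have hfin : 1 + (⨆ y, ∫⁻ z, ‖z‖ₑ ^ p ∂(κ y)) ≠ ∞ :=
    ENNReal.add_ne_top.2 ⟨ENNReal.one_ne_top, hκ.ne⟩
  refine ⟨(1 + ⨆ y, ∫⁻ z, ‖z‖ₑ ^ p ∂(κ y)).toReal, ENNReal.toReal_nonneg, fun y => ?_⟩
  rw [ENNReal.ofReal_toReal hfin]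
  calc ∫⁻ z, ‖z‖ₑ ∂(κ y) ≤ ∫⁻ z, (1 + ‖z‖ₑ ^ p) ∂(κ y) := by
        refine lintegral_mono fun z => ?_
        rcases le_total ‖z‖ₑ 1 with hz | hz
        · exact hz.trans le_self_add
        · exact (ENNReal.le_rpow_self_of_one_le hz hp).trans le_add_self
    _ = 1 + ∫⁻ z, ‖z‖ₑ ^ p ∂(κ y) := by simp [lintegral_add_left measurable_const]
    _ ≤ 1 + ⨆ y, ∫⁻ z, ‖z‖ₑ ^ p ∂(κ y) := by
        gcongr
        exact le_iSup (fun y => ∫⁻ z, ‖z‖ₑ ^ p ∂(κ y)) y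

theorem HasBoundedMoments.integrable [IsMarkovKernel κ] (hp : 1 ≤ p) (hκ : HasBoundedMoments p κ)
    (y : Y) : Integrable (fun z => z) (κ y) := by
  obtain ⟨C, -, hC⟩ := hκ.exists_lintegral_enorm_le hp
  exact ⟨aestronglyMeasurable_id, (hC y).trans_lt ENNReal.ofReal_lt_top⟩

theorem HasBoundedMoments.isBddMeas_meanQ {ζ : Kernel (S × A) ℝ} [IsMarkovKernel ζ] (hp : 1 ≤ p)
    (hζ : HasBoundedMoments p ζ) : IsBddMeas (meanQ ζ) := by
  obtain ⟨C, hC0, hC⟩ := hζ.exists_lintegral_enorm_le hp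
  refine ⟨measurable_id.stronglyMeasurable.integral_kernel.measurable, C, fun y => ?_⟩
  rw [← Real.norm_eq_abs, ← ENNReal.ofReal_le_ofReal_iff hC0, ofReal_norm]
  exact (enorm_integral_le_lintegral_enorm _).trans (hC y)

theorem HasBoundedMoments.actionAverage {π : Kernel S A} [IsMarkovKernel π]
    {ζ : Kernel (S × A) ℝ} [IsMarkovKernel ζ] (hζ : HasBoundedMoments p ζ) :
    HasBoundedMoments p (actionAverage π ζ) := by
  refine (iSup_le fun x => ?_).trans_lt hζ
  rw [lintegral_actionAverage (by fun_prop)]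
  simpa using lintegral_mono (μ := π x)
    fun a => le_iSup (fun y => ∫⁻ z, ‖z‖ₑ ^ p ∂(ζ y)) (x, a)

theorem HasBoundedMoments.backup {η : Kernel Y X} [IsMarkovKernel η] {α : Kernel X ℝ}
    [IsMarkovKernel α] (hp : 1 ≤ p) (hα : HasBoundedMoments p α) {g : Y × X × ℝ → ℝ}
    (hg : Measurable g) {B : ℝ} (hB : ∀ w, |g w| ≤ B + |w.2.2|) :
    HasBoundedMoments p (backup η α g) := by
  set m := ⨆ x, ∫⁻ z, ‖z‖ₑ ^ p ∂(α x)
  have hfin : 2 ^ (p - 1) * (ENNReal.ofReal B ^ p + m) < ∞ :=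
    ENNReal.mul_lt_top (ENNReal.rpow_lt_top_of_nonneg (by linarith) (by simp))
      (ENNReal.add_lt_top.2
        ⟨ENNReal.rpow_lt_top_of_nonneg (by linarith) ENNReal.ofReal_ne_top, hα⟩)
  have hpow : ∀ w, ‖g w‖ₑ ^ p ≤ 2 ^ (p - 1) * (ENNReal.ofReal B ^ p + ‖w.2.2‖ₑ ^ p) := fun w =>
    calc ‖g w‖ₑ ^ p ≤ (ENNReal.ofReal B + ‖w.2.2‖ₑ) ^ p := by
          gcongr
          rw [← ofReal_norm, ← ofReal_norm]
          exact (ENNReal.ofReal_le_ofReal (hB w)).trans ENNReal.ofReal_add_le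
      _ ≤ _ := ENNReal.rpow_add_le_mul_rpow_add_rpow _ _ hp
  refine (iSup_le fun y => ?_).trans_lt hfin
  rw [lintegral_backup hg (by fun_prop)]
  calc ∫⁻ x, ∫⁻ z, ‖g (y, x, z)‖ₑ ^ p ∂(α x) ∂(η y)
      ≤ ∫⁻ _, 2 ^ (p - 1) * (ENNReal.ofReal B ^ p + m) ∂(η y) := by
        refine lintegral_mono fun x => ?_
        refine (lintegral_mono fun z => hpow (y, x, z)).trans ?_
        rw [lintegral_const_mul _ (by fun_prop), lintegral_add_left measurable_const,
          lintegral_const, measure_univ, mul_one]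
        gcongr
        exact le_iSup (fun x => ∫⁻ z, ‖z‖ₑ ^ p ∂(α x)) x
    _ = 2 ^ (p - 1) * (ENNReal.ofReal B ^ p + m) := by simp

end Moments

section PenalizedBackup

/-- The distributional Bellman backup of a kernel `α` of return laws of the states, where the
state `x'` reached is charged the penalty `k x'`. -/
def penalizedBackup (M : MDP S A) (k : S → ℝ) (α : Kernel S ℝ) : Kernel (S × A) ℝ :=
  backup M.P α fun w => M.r w.1 + M.γ * (w.2.2 - k w.2.1)

variable {M : MDP S A} {k : S → ℝ} {α : Kernel S ℝ} [IsMarkovKernel α] {p : ℝ}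

theorem measurable_penalized (hk : Measurable k) :
    Measurable fun w : (S × A) × S × ℝ => M.r w.1 + M.γ * (w.2.2 - k w.2.1) :=
  (M.measurable_r.comp measurable_fst).add (by fun_prop)

theorem isMarkovKernel_penalizedBackup (hk : Measurable k) :
    IsMarkovKernel (penalizedBackup M k α) :=
  isMarkovKernel_backup (measurable_penalized hk)

theorem HasBoundedMoments.penalizedBackup (hp : 1 ≤ p) (hα : HasBoundedMoments p α)
    (hk : Measurable k) {K : ℝ} (hK : ∀ x, |k x| ≤ K) :
    HasBoundedMoments p (penalizedBackup M k α) := by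
  obtain ⟨R, hR⟩ := M.bounded_r
  refine hα.backup hp (measurable_penalized hk) (B := R + K) fun w => ?_
  have hle : |M.γ * (w.2.2 - k w.2.1)| ≤ |w.2.2 - k w.2.1| := by
    rw [abs_mul, abs_of_pos M.γ_pos]
    exact mul_le_of_le_one_left (abs_nonneg _) M.γ_lt_one.le
  linarith [abs_add_le (M.r w.1) (M.γ * (w.2.2 - k w.2.1)), hR w.1, hK w.2.1,
    abs_sub w.2.2 (k w.2.1)]

theorem meanQ_penalizedBackup_actionAverage {π : Kernel S A} [IsMarkovKernel π]
    {ζ : Kernel (S × A) ℝ} [IsMarkovKernel ζ] (hp : 1 ≤ p) (hζ : HasBoundedMoments p ζ)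
    (hk : Measurable k) {K : ℝ} (hK : ∀ x, |k x| ≤ K) (y : S × A) :
    meanQ (penalizedBackup M k (actionAverage π ζ)) y
      = M.r y + M.γ * ∫ x', (∫ a, meanQ ζ (x', a) ∂(π x') - k x') ∂(M.P y) := by
  have hmarkov : IsMarkovKernel (penalizedBackup M k (DERL.actionAverage π ζ)) :=
    isMarkovKernel_penalizedBackup hk
  have hmean : ∀ x, ∫ z, (M.r y + M.γ * (z - k x)) ∂(actionAverage π ζ x)
      = M.r y + M.γ * (∫ a, meanQ ζ (x, a) ∂(π x) - k x) := fun x => by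
    have hint := hζ.actionAverage.integrable (κ := actionAverage π ζ) hp x
    have hz_int : Integrable (fun z => M.γ * (z - k x)) (actionAverage π ζ x) :=
      (hint.sub (integrable_const _)).const_mul _
    rw [integral_add (integrable_const _) hz_int,
      integral_const_mul, integral_sub hint (integrable_const _), integral_actionAverage hint]
    simp [meanQ]
  have hvalue := (isValueOperator_integral π).integrable (hζ.isBddMeas_meanQ hp) (M.P y)
  have hpenalty : Integrable k (M.P y) := .of_bound hk.aestronglyMeasurable K (ae_of_all _ hK)
  have hx_int : Integrable (fun x => M.γ * (∫ a, meanQ ζ (x, a) ∂(π x) - k x)) (M.P y) :=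
    (hvalue.sub hpenalty).const_mul _
  have hint := (hζ.actionAverage.penalizedBackup hp hk hK).integrable
    (κ := penalizedBackup M k (actionAverage π ζ)) hp y
  rw [meanQ, penalizedBackup, integral_backup (measurable_penalized hk) hint]
  simp_rw [hmean]
  rw [integral_add (integrable_const _) hx_int, integral_const_mul]
  simp

end PenalizedBackup

section SoftBackup

variable {M : MDP S A} {πref π : Kernel S A} {τ p : ℝ} {ζ : Kernel (S × A) ℝ}

theorem softDistBellman_eq_penalizedBackup [IsMarkovKernel π] [IsMarkovKernel ζ]
    (hπ : Measurable (klFn π πref)) :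
    softDistBellman M πref τ π ζ
      = penalizedBackup M (fun x => τ * klFn π πref x) (actionAverage π ζ) := by
  rw [penalizedBackup, ← backup_step M (measurable_penalized (hπ.const_mul τ))]
  refine congrArg (Kernel.map _) (funext fun w => ?_)
  ring

variable [IsMarkovKernel πref] {q : S × A → ℝ}

theorem abs_mul_klFn_boltzmann_le (hq : IsBddMeas q) {C : ℝ} (hC : ∀ y, |q y| ≤ C) (hτ : 0 < τ)
    (x : S) : |τ * klFn (boltzmann πref τ q) πref x| ≤ C + C := by
  have := isMarkovKernel_boltzmann (πref := πref) hq hτ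
  rw [mul_klFn_boltzmann hq hτ]
  exact (abs_sub _ _).trans (add_le_add ((isValueOperator_integral _).abs_le hq hC x)
    ((isValueOperator_softValue πref hτ).abs_le hq hC x))

variable [IsMarkovKernel ζ]

theorem softDistBellmanOpt_eq_penalizedBackup (hζ : IsBddMeas (meanQ ζ)) (hτ : 0 < τ) :
    softDistBellmanOpt M πref τ ζ
      = penalizedBackup M (fun x => τ * klFn (boltzmann πref τ (meanQ ζ)) πref x)
          (actionAverage (boltzmann πref τ (meanQ ζ)) ζ) :=
  have := isMarkovKernel_boltzmann (πref := πref) hζ hτ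
  softDistBellman_eq_penalizedBackup (measurable_klFn_boltzmann hζ hτ)

theorem isMarkovKernel_softDistBellmanOpt (hζ : IsBddMeas (meanQ ζ)) (hτ : 0 < τ) :
    IsMarkovKernel (softDistBellmanOpt M πref τ ζ) := by
  have := isMarkovKernel_boltzmann (πref := πref) hζ hτ
  rw [softDistBellmanOpt_eq_penalizedBackup hζ hτ]
  exact isMarkovKernel_penalizedBackup ((measurable_klFn_boltzmann hζ hτ).const_mul τ)

theorem HasBoundedMoments.softDistBellmanOpt (hp : 1 ≤ p) (hζ : HasBoundedMoments p ζ)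
    (hτ : 0 < τ) : HasBoundedMoments p (softDistBellmanOpt M πref τ ζ) := by
  have hq := hζ.isBddMeas_meanQ hp
  obtain ⟨C, hC⟩ := hq.2
  have := isMarkovKernel_boltzmann (πref := πref) hq hτ
  rw [softDistBellmanOpt_eq_penalizedBackup hq hτ]
  exact hζ.actionAverage.penalizedBackup hp ((measurable_klFn_boltzmann hq hτ).const_mul τ)
    (abs_mul_klFn_boltzmann_le hq hC hτ)

theorem meanQ_softDistBellmanOpt (hp : 1 ≤ p) (hζ : HasBoundedMoments p ζ) (hτ : 0 < τ) :
    meanQ (softDistBellmanOpt M πref τ ζ) = bellman M (softValue πref τ) (meanQ ζ) := by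
  have hq := hζ.isBddMeas_meanQ hp
  obtain ⟨C, hC⟩ := hq.2
  have := isMarkovKernel_boltzmann (πref := πref) hq hτ
  funext y
  rw [softDistBellmanOpt_eq_penalizedBackup hq hτ, meanQ_penalizedBackup_actionAverage hp hζ
    ((measurable_klFn_boltzmann hq hτ).const_mul τ) (abs_mul_klFn_boltzmann_le hq hC hτ), bellman]
  simp only [mul_klFn_boltzmann hq hτ, sub_sub_cancel]

end SoftBackup

section Returns

theorem summable_discounted {γ C : ℝ} (hγ0 : 0 ≤ γ) (hγ1 : γ < 1) {f : ℕ → ℝ}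
    (hf : ∀ t, |f t| ≤ C) : Summable fun t => γ ^ t * f t := by
  refine Summable.of_norm_bounded ((summable_geometric_of_lt_one hγ0 hγ1).mul_right C) fun t => ?_
  rw [norm_mul, norm_pow, Real.norm_of_nonneg hγ0]
  exact mul_le_mul_of_nonneg_left (hf t) (by positivity)

theorem abs_tsum_discounted_le {γ C : ℝ} (hγ0 : 0 ≤ γ) (hγ1 : γ < 1) {f : ℕ → ℝ}
    (hf : ∀ t, |f t| ≤ C) : |∑' t, γ ^ t * f t| ≤ C / (1 - γ) := by
  have hsum := (hasSum_geometric_of_lt_one hγ0 hγ1).mul_right C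
  rw [inv_mul_eq_div] at hsum
  rw [← Real.norm_eq_abs]
  refine tsum_of_norm_bounded hsum fun t => ?_
  rw [norm_mul, norm_pow, Real.norm_of_nonneg hγ0]
  exact mul_le_mul_of_nonneg_left (hf t) (by positivity)

/-- The discounted return `∑ γ ^ t r (w t)` of a trajectory `w`. -/
def discountedReturn (M : MDP S A) (w : ℕ → S × A) : ℝ := ∑' t : ℕ, M.γ ^ t * M.r (w t)

variable (M : MDP S A)

theorem measurable_discountedReturn : Measurable (discountedReturn M) :=
  Measurable.tsum fun t => (M.measurable_r.comp (measurable_pi_apply t)).const_mul _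

theorem discountedReturn_eq_add_shift (w : ℕ → S × A) :
    discountedReturn M w = M.r (w 0) + M.γ * discountedReturn M (shift w) := by
  obtain ⟨R, hR⟩ := M.bounded_r
  rw [discountedReturn, (summable_discounted M.γ_pos.le M.γ_lt_one
    (f := fun t => M.r (w t)) fun t => hR _).tsum_eq_zero_add, discountedReturn, ← tsum_mul_left]
  simp only [pow_zero, one_mul, pow_succ', mul_assoc, shift]

variable (π : Kernel S A) [IsMarkovKernel π]

theorem returnDist_eq_map_chain :
    returnDist M π = (chain (step M π)).map (discountedReturn M) := by
  rw [returnDist, dif_pos ‹_›]; rfl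

instance : IsMarkovKernel (returnDist M π) := by
  rw [returnDist_eq_map_chain]
  exact Kernel.IsMarkovKernel.map _ (measurable_discountedReturn M)

theorem ae_returnDist_abs_le {R : ℝ} (hR : ∀ y, |M.r y| ≤ R) (y : S × A) :
    ∀ᵐ z ∂(returnDist M π y), |z| ≤ R / (1 - M.γ) := by
  rw [returnDist_eq_map_chain, Kernel.map_apply _ (measurable_discountedReturn M),
    ae_map_iff (p := fun z => |z| ≤ R / (1 - M.γ)) (measurable_discountedReturn M).aemeasurable
      (measurableSet_le measurable_norm measurable_const)]
  exact ae_of_all _ fun w => abs_tsum_discounted_le M.γ_pos.le M.γ_lt_one fun t => hR _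

theorem hasBoundedMoments_returnDist {p : ℝ} (hp : 0 ≤ p) :
    HasBoundedMoments p (returnDist M π) :=
  have ⟨_, hR⟩ := M.bounded_r
  hasBoundedMoments_of_ae_abs_le hp (ae_returnDist_abs_le M π hR)

theorem ae_chain_reward_zero_eq (y : S × A) :
    ∀ᵐ w ∂(chain (step M π) y), M.r (w 0) = M.r y := by
  have hset : MeasurableSet {y' | M.r y' = M.r y} :=
    measurableSet_eq_fun M.measurable_r measurable_const
  have heval : Measurable fun w : ℕ → S × A => w 0 := measurable_pi_apply 0
  refine ae_of_ae_map (p := fun y' => M.r y' = M.r y) heval.aemeasurable ?_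
  rw [chain_map_eval_zero, ae_dirac_iff hset]

theorem returnDist_eq_penalizedBackup :
    returnDist M π = penalizedBackup M 0 (actionAverage π (returnDist M π)) := by
  have hpen := measurable_penalized (M := M) (k := 0) measurable_const
  rw [penalizedBackup, ← backup_step M hpen]
  refine Kernel.ext fun y => Measure.ext_of_lintegral _ fun f hf => ?_
  have hpen' : Measurable fun w : (S × A) × (S × A) × ℝ =>
      M.r w.1 + M.γ * (w.2.2 - (0 : S → ℝ) w.2.1.1) :=
    hpen.comp (f := fun w : (S × A) × (S × A) × ℝ => (w.1, w.2.1.1, w.2.2)) (by fun_prop)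
  have hmeas := measurable_discountedReturn M
  have hf_affine : Measurable fun z => f (M.r y + M.γ * z) := by fun_prop
  rw [lintegral_backup hpen' hf, returnDist_eq_map_chain]
  simp only [Kernel.map_apply _ hmeas, Pi.zero_apply, sub_zero, lintegral_map hf_affine hmeas,
    lintegral_map hf hmeas]
  calc ∫⁻ w, f (discountedReturn M w) ∂(chain (step M π) y)
      = ∫⁻ w, f (M.r y + M.γ * discountedReturn M (shift w)) ∂(chain (step M π) y) := by
        refine lintegral_congr_ae ((ae_chain_reward_zero_eq M π y).mono fun w hw => ?_)
        simp only [discountedReturn_eq_add_shift M w, hw]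
    _ = ∫⁻ w, f (M.r y + M.γ * discountedReturn M w) ∂((chain (step M π) ∘ₖ step M π) y) := by
        rw [← map_shift_chain, Kernel.map_apply _ measurable_shift,
          lintegral_map (by fun_prop) measurable_shift]
    _ = _ := Kernel.lintegral_comp _ _ _ (hf_affine.comp hmeas)

theorem isBddMeas_qValue : IsBddMeas (qValue M π) :=
  (hasBoundedMoments_returnDist M π zero_le_one).isBddMeas_meanQ le_rfl

theorem bellman_qValue :
    bellman M (fun q x => ∫ a, q (x, a) ∂(π x)) (qValue M π) = qValue M π := by
  funext y
  conv_rhs => rw [qValue, returnDist_eq_penalizedBackup]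
  rw [meanQ_penalizedBackup_actionAverage le_rfl (hasBoundedMoments_returnDist M π zero_le_one)
    (k := 0) measurable_const (K := 0) (by simp)]
  simp [bellman, qValue]

end Returns

section Coupling

theorem lintegral_add_rpow_le {Ω : Type*} [MeasurableSpace Ω] {μ : Measure Ω} {p : ℝ} (hp : 1 ≤ p)
    {f g : Ω → ℝ≥0∞} (hf : AEMeasurable f μ) (hg : AEMeasurable g μ) {a b : ℝ≥0∞}
    (ha : ∫⁻ z, f z ^ p ∂μ ≤ a ^ p) (hb : ∫⁻ z, g z ^ p ∂μ ≤ b ^ p) :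
    ∫⁻ z, (f z + g z) ^ p ∂μ ≤ (a + b) ^ p := by
  have hp0 : 0 < p := by linarith
  have h := ENNReal.lintegral_Lp_add_le hf hg hp
  simp only [Pi.add_apply, one_div] at h
  rw [← ENNReal.rpow_inv_le_iff hp0]
  exact h.trans (add_le_add ((ENNReal.rpow_inv_le_iff hp0).2 ha)
    ((ENNReal.rpow_inv_le_iff hp0).2 hb))

variable {Y : Type*} [MeasurableSpace Y] {p : ℝ} {κ κ' κ'' : Kernel Y ℝ} {d d' : ℝ≥0∞}

theorem muWass_le_of_forall {q : ℝ} (hq : 1 ≤ q) {ω : Measure Y} [IsProbabilityMeasure ω]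
    (h : ∀ y, wass p (κ y) (κ' y) ≤ d) : muWass p q ω κ κ' ≤ d := by
  have hq0 : 0 < q := by linarith
  rw [muWass, one_div, ENNReal.rpow_inv_le_iff hq0]
  calc ∫⁻ y, wass p (κ y) (κ' y) ^ q ∂ω ≤ ∫⁻ _, d ^ q ∂ω :=
        lintegral_mono fun y => ENNReal.rpow_le_rpow (h y) hq0.le
    _ = d ^ q := by simp

/-- The measures `κ_y` and `κ'_y` have couplings of `p`-cost at most `d ^ p`, which can be chosen
to depend measurably on `y`. This bounds `w_p(κ_y, κ'_y)` by `d`, and measurability is what lets the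
couplings be averaged over `y`. -/
def HasCoupling (p : ℝ) (κ κ' : Kernel Y ℝ) (d : ℝ≥0∞) : Prop :=
  ∃ c : Kernel Y (ℝ × ℝ), c.fst = κ ∧ c.snd = κ' ∧ ∀ y, ∫⁻ z, edist z.1 z.2 ^ p ∂(c y) ≤ d ^ p

theorem HasCoupling.mono (hp : 0 ≤ p) (h : HasCoupling p κ κ' d) (hd : d ≤ d') :
    HasCoupling p κ κ' d' :=
  have ⟨c, hfst, hsnd, hcost⟩ := h
  ⟨c, hfst, hsnd, fun y => (hcost y).trans (ENNReal.rpow_le_rpow hd hp)⟩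

theorem HasCoupling.wass_le (hp : 0 < p) (h : HasCoupling p κ κ' d) (y : Y) :
    wass p (κ y) (κ' y) ≤ d := by
  obtain ⟨c, rfl, rfl, hcost⟩ := h
  rw [wass, one_div, ENNReal.rpow_inv_le_iff hp]
  exact (iInf₂_le (c y) ⟨(Kernel.fst_apply c y).symm, (Kernel.snd_apply c y).symm⟩).trans (hcost y)

theorem hasCoupling_map {Ω : Type*} [MeasurableSpace Ω] {η : Kernel Y Ω} [IsMarkovKernel η]
    {f g : Ω → ℝ} (hf : Measurable f) (hg : Measurable g) (hp : 0 ≤ p)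
    (h : ∀ w, edist (f w) (g w) ≤ d) : HasCoupling p (η.map f) (η.map g) d := by
  have hfg : Measurable fun w => (f w, g w) := hf.prodMk hg
  refine ⟨η.map fun w => (f w, g w), Kernel.fst_map_prod _ hg, Kernel.snd_map_prod _ hf,
    fun y => ?_⟩
  rw [Kernel.map_apply _ hfg, lintegral_map (by fun_prop) hfg]
  calc ∫⁻ w, edist (f w) (g w) ^ p ∂(η y) ≤ ∫⁻ _, d ^ p ∂(η y) :=
        lintegral_mono fun w => ENNReal.rpow_le_rpow (h w) hp
    _ = d ^ p := by simp

theorem isMarkovKernel_of_fst {Z W : Type*} [MeasurableSpace Z] [MeasurableSpace W]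
    {c : Kernel Y (Z × W)} [IsMarkovKernel c.fst] : IsMarkovKernel c :=
  ⟨fun y => ⟨by rw [← Measure.fst_univ, Measure.fst, ← Kernel.fst_apply, measure_univ]⟩⟩

theorem exists_glued_kernel {X Z W : Type*} [MeasurableSpace X] [MeasurableSpace Z]
    [MeasurableSpace W] [MeasurableSpace.CountableOrCountablyGenerated Y Z] [StandardBorelSpace W]
    [Nonempty W] {c : Kernel Y (X × Z)} [IsSFiniteKernel c] {c' : Kernel Y (Z × W)}
    [IsFiniteKernel c'] (h : c.snd = c'.fst) :
    ∃ G : Kernel Y ((X × Z) × W), G.map Prod.fst = c ∧ G.map (fun w => (w.1.2, w.2)) = c' := by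
  have hproj : Measurable fun w : Y × X × Z => (w.1, w.2.2) := by fun_prop
  refine ⟨c ⊗ₖ c'.condKernel.comap (fun w => (w.1, w.2.2)) hproj,
    by rw [← Kernel.fst_eq, Kernel.fst_compProd], ?_⟩
  refine Kernel.ext fun y => Measure.ext_of_lintegral _ fun f hf => ?_
  have hF : Measurable fun w : Y × Z => ∫⁻ z, f (w.2, z) ∂(c'.condKernel w) :=
    Measurable.lintegral_kernel_prod_right' (f := fun v : (Y × Z) × W => f (v.1.2, v.2))
      (by fun_prop)
  rw [Kernel.map_apply _ (by fun_prop), lintegral_map hf (by fun_prop),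
    Kernel.lintegral_compProd _ _ _ (by fun_prop)]
  calc ∫⁻ z, ∫⁻ z', f (z.2, z') ∂(c'.condKernel (y, z.2)) ∂(c y)
      = ∫⁻ z, ∫⁻ z', f (z, z') ∂(c'.condKernel (y, z)) ∂(c.snd y) :=
        (Kernel.lintegral_snd c y (hF.comp measurable_prodMk_left)).symm
    _ = ∫⁻ z, f z ∂((c'.fst ⊗ₖ c'.condKernel) y) := by
        rw [h, Kernel.lintegral_compProd _ _ _ hf]
    _ = ∫⁻ z, f z ∂(c' y) := by rw [c'.disintegrate]

theorem HasCoupling.trans [IsMarkovKernel κ] [IsMarkovKernel κ'] (hp : 1 ≤ p)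
    (h : HasCoupling p κ κ' d) (h' : HasCoupling p κ' κ'' d') :
    HasCoupling p κ κ'' (d + d') := by
  obtain ⟨c, hc_fst, hc_snd, hc⟩ := h
  obtain ⟨c', hc'_fst, hc'_snd, hc'⟩ := h'
  have : IsMarkovKernel c.fst := hc_fst ▸ ‹_›
  have : IsMarkovKernel c'.fst := hc'_fst ▸ ‹_›
  have := isMarkovKernel_of_fst (c := c)
  have := isMarkovKernel_of_fst (c := c')
  obtain ⟨G, rfl, rfl⟩ := exists_glued_kernel (hc_snd.trans hc'_fst.symm)
  have hcost : Measurable fun z : ℝ × ℝ => edist z.1 z.2 ^ p := by fun_prop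
  refine ⟨G.map fun w => (w.1.1, w.2), ?_, ?_, fun y => ?_⟩
  · rw [← hc_fst, Kernel.fst_eq, Kernel.fst_eq, ← Kernel.map_comp_right _ (by fun_prop)
      (by fun_prop), ← Kernel.map_comp_right _ (by fun_prop) (by fun_prop)]
    rfl
  · rw [← hc'_snd, Kernel.snd_eq, Kernel.snd_eq, ← Kernel.map_comp_right _ (by fun_prop)
      (by fun_prop), ← Kernel.map_comp_right _ (by fun_prop) (by fun_prop)]
    rfl
  · specialize hc y
    specialize hc' y
    rw [Kernel.map_apply _ (by fun_prop), lintegral_map hcost (by fun_prop)] at hc hc' ⊢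
    calc ∫⁻ w, edist w.1.1 w.2 ^ p ∂(G y)
        ≤ ∫⁻ w, (edist w.1.1 w.1.2 + edist w.1.2 w.2) ^ p ∂(G y) := by
          gcongr
          exact edist_triangle _ _ _
      _ ≤ (d + d') ^ p := lintegral_add_rpow_le hp (by fun_prop) (by fun_prop) hc hc'

theorem HasBoundedMoments.exists_hasCoupling [IsMarkovKernel κ] [IsMarkovKernel κ'] (hp : 1 ≤ p)
    (h : HasBoundedMoments p κ) (h' : HasBoundedMoments p κ') :
    ∃ d ≠ ∞, HasCoupling p κ κ' d := by
  have hp0 : 0 < p := by linarith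
  refine ⟨(⨆ y, ∫⁻ z, ‖z‖ₑ ^ p ∂(κ y)) ^ p⁻¹ + (⨆ y, ∫⁻ z, ‖z‖ₑ ^ p ∂(κ' y)) ^ p⁻¹,
    ENNReal.add_ne_top.2 ⟨ENNReal.rpow_ne_top_of_nonneg (by positivity) h.ne,
      ENNReal.rpow_ne_top_of_nonneg (by positivity) h'.ne⟩,
    κ ×ₖ κ', Kernel.fst_prod _ _, Kernel.snd_prod _ _, fun y => ?_⟩
  have hnorm : Measurable fun z : ℝ => ‖z‖ₑ ^ p := by fun_prop
  calc ∫⁻ z, edist z.1 z.2 ^ p ∂((κ ×ₖ κ') y)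
      ≤ ∫⁻ z, (‖z.1‖ₑ + ‖z.2‖ₑ) ^ p ∂((κ ×ₖ κ') y) := by
        gcongr with z
        rw [edist_eq_enorm_sub]
        exact enorm_sub_le
    _ ≤ _ := lintegral_add_rpow_le hp (by fun_prop) (by fun_prop) ?_ ?_
  · rw [← Kernel.lintegral_fst _ _ hnorm, Kernel.fst_prod, ENNReal.rpow_inv_rpow hp0.ne']
    exact le_iSup (fun y => ∫⁻ z, ‖z‖ₑ ^ p ∂(κ y)) y
  · rw [← Kernel.lintegral_snd _ _ hnorm, Kernel.snd_prod, ENNReal.rpow_inv_rpow hp0.ne']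
    exact le_iSup (fun y => ∫⁻ z, ‖z‖ₑ ^ p ∂(κ' y)) y

theorem ae_prod_edist_le {μ ν : Measure ℝ} {C : ℝ} (hμ : ∀ᵐ z ∂μ, |z| ≤ C)
    (hν : ∀ᵐ z ∂ν, |z| ≤ C) : ∀ᵐ z ∂(μ.prod ν), edist z.1 z.2 ≤ ENNReal.ofReal (2 * C) := by
  filter_upwards [Measure.quasiMeasurePreserving_fst.ae hμ,
    Measure.quasiMeasurePreserving_snd.ae hν] with z hz hz'
  rw [edist_dist, Real.dist_eq]
  exact ENNReal.ofReal_le_ofReal (by linarith [abs_sub z.1 z.2])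

theorem hasCoupling_of_eq_add [IsMarkovKernel κ] [IsMarkovKernel κ'] {β β' : Kernel Y ℝ}
    [IsSFiniteKernel β'] {s : ℝ≥0∞} (hκ : κ = β + β')
    (hβ : ∀ y, β y = s • κ' y) (hp : 1 ≤ p) {C : ℝ} (hC : ∀ y, ∀ᵐ z ∂(κ y), |z| ≤ C)
    (hC' : ∀ y, ∀ᵐ z ∂(κ' y), |z| ≤ C) :
    HasCoupling p κ κ' ((1 - s) ^ p⁻¹ * ENNReal.ofReal (2 * C)) := by
  have hp0 : 0 < p := by linarith
  have hmass : ∀ y, s + β' y univ = 1 := fun y => by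
    have h := measure_univ (μ := κ y)
    simpa [hκ, hβ] using h
  have hmass' : ∀ y, β' y univ = 1 - s := fun y => by
    exact ENNReal.eq_sub_of_add_eq' ENNReal.one_ne_top (by rw [add_comm]; exact hmass y)
  have hdiag : Measurable fun z : ℝ => (z, z) := by fun_prop
  -- Couple the common part `β` with itself, and the rest of `κ` independently with `κ'`.
  refine ⟨β.map (fun z => (z, z)) + β' ×ₖ κ', ?_, ?_, fun y => ?_⟩
  · refine Kernel.ext fun y => ?_
    rw [Kernel.fst_apply, add_apply, Measure.map_add _ _ measurable_fst, hκ,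
      Kernel.map_apply _ hdiag, Measure.map_map measurable_fst hdiag, Kernel.prod_apply,
      Measure.map_fst_prod]
    simp [Function.comp_def]
  · refine Kernel.ext fun y => ?_
    rw [Kernel.snd_apply, add_apply, Measure.map_add _ _ measurable_snd,
      Kernel.map_apply _ hdiag, Measure.map_map measurable_snd hdiag, Kernel.prod_apply,
      Measure.map_snd_prod]
    simp only [Function.comp_def, Measure.map_id', hβ, ← add_smul, hmass, one_smul]
  · have hβ' : ∀ᵐ z ∂(β' y), |z| ≤ C :=
      (hC y).filter_mono (ae_mono (by rw [hκ]; exact Measure.le_add_left le_rfl))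
    rw [add_apply, lintegral_add_measure, Kernel.map_apply _ hdiag,
      lintegral_map (by fun_prop) hdiag, Kernel.prod_apply]
    calc _ ≤ ∫⁻ _, ENNReal.ofReal (2 * C) ^ p ∂((β' y).prod (κ' y)) := by
          simp only [edist_self, ENNReal.zero_rpow_of_pos hp0, lintegral_zero, zero_add]
          exact lintegral_mono_ae ((ae_prod_edist_le hβ' (hC' y)).mono
            fun z hz => ENNReal.rpow_le_rpow hz hp0.le)
      _ = ((1 - s) ^ p⁻¹ * ENNReal.ofReal (2 * C)) ^ p := by
          rw [lintegral_const, ← univ_prod_univ, Measure.prod_prod, hmass', measure_univ, mul_one,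
            ENNReal.mul_rpow_of_nonneg _ _ hp0.le, ENNReal.rpow_inv_rpow hp0.ne', mul_comm]

end Coupling

section CouplingBackup

theorem map_backup {Y X Z Z' W W' : Type*} [MeasurableSpace Y] [MeasurableSpace X]
    [MeasurableSpace Z] [MeasurableSpace Z'] [MeasurableSpace W] [MeasurableSpace W']
    {η : Kernel Y X} {α : Kernel X Z} [IsSFiniteKernel η] [IsSFiniteKernel α] {g : Y × X × Z → W}
    {g' : Y × X × Z' → W'} {h : W → W'} {f : Z → Z'} (hg : Measurable g) (hg' : Measurable g')
    (hh : Measurable h) (hf : Measurable f) (hcomm : ∀ y x z, h (g (y, x, z)) = g' (y, x, f z)) :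
    (backup η α g).map h = backup η (α.map f) g' := by
  refine Kernel.ext fun y => Measure.ext_of_lintegral _ fun F hF => ?_
  rw [Kernel.map_apply _ hh, lintegral_map hF hh,
    lintegral_backup hg (f := fun w => F (h w)) (hF.comp hh), lintegral_backup hg' hF]
  refine lintegral_congr fun x => ?_
  have hg'_section : Measurable fun z => g' (y, x, z) := by fun_prop
  rw [Kernel.map_apply _ hf,
    lintegral_map (f := fun z => F (g' (y, x, z))) (hF.comp hg'_section) hf]
  simp only [hcomm]

theorem map_actionAverage {Z Z' : Type*} [MeasurableSpace Z] [MeasurableSpace Z']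
    {π : Kernel S A} [IsSFiniteKernel π] {κ : Kernel (S × A) Z} [IsSFiniteKernel κ] {f : Z → Z'}
    (hf : Measurable f) : (actionAverage π κ).map f = actionAverage π (κ.map f) := by
  refine Kernel.ext fun x => Measure.ext_of_lintegral _ fun F hF => ?_
  rw [Kernel.map_apply _ hf, lintegral_map hF hf,
    lintegral_actionAverage (f := fun z => F (f z)) (hF.comp hf), lintegral_actionAverage hF]
  simp only [Kernel.map_apply _ hf, lintegral_map hF hf]

variable {p : ℝ} {d : ℝ≥0∞}

theorem HasCoupling.actionAverage {π : Kernel S A} [IsMarkovKernel π] {ζ ζ' : Kernel (S × A) ℝ}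
    [IsMarkovKernel ζ] (h : HasCoupling p ζ ζ' d) :
    HasCoupling p (actionAverage π ζ) (actionAverage π ζ') d := by
  obtain ⟨c, rfl, rfl, hc⟩ := h
  have := isMarkovKernel_of_fst (c := c)
  refine ⟨DERL.actionAverage π c, ?_, ?_, fun x => ?_⟩
  · rw [Kernel.fst_eq, map_actionAverage measurable_fst, ← Kernel.fst_eq]
  · rw [Kernel.snd_eq, map_actionAverage measurable_snd, ← Kernel.snd_eq]
  · rw [lintegral_actionAverage (by fun_prop)]
    calc ∫⁻ a, ∫⁻ z, edist z.1 z.2 ^ p ∂(c (x, a)) ∂(π x) ≤ ∫⁻ _, d ^ p ∂(π x) :=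
          lintegral_mono fun a => hc (x, a)
      _ = d ^ p := by simp

theorem HasCoupling.backup {Y X : Type*} [MeasurableSpace Y] [MeasurableSpace X] {η : Kernel Y X}
    [IsMarkovKernel η] {α α' : Kernel X ℝ} [IsMarkovKernel α] (hp : 1 ≤ p)
    (h : HasCoupling p α α' d) {g g' : Y × X × ℝ → ℝ} (hg : Measurable g) (hg' : Measurable g')
    {l b : ℝ≥0∞} (hdist : ∀ y x z z', edist (g (y, x, z)) (g' (y, x, z')) ≤ l * (edist z z' + b)) :
    HasCoupling p (backup η α g) (backup η α' g') (l * (d + b)) := by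
  have hp0 : 0 ≤ p := by linarith
  obtain ⟨c, rfl, rfl, hc⟩ := h
  have := isMarkovKernel_of_fst (c := c)
  have hG : Measurable fun w : Y × X × ℝ × ℝ =>
      (g (w.1, w.2.1, w.2.2.1), g' (w.1, w.2.1, w.2.2.2)) := by fun_prop
  refine ⟨DERL.backup η c _, ?_, ?_, fun y => (lintegral_backup hG (by fun_prop) y).trans_le ?_⟩
  · rw [Kernel.fst_eq, Kernel.fst_eq]
    exact map_backup hG hg measurable_fst measurable_fst fun _ _ _ => rfl
  · rw [Kernel.snd_eq, Kernel.snd_eq]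
    exact map_backup hG hg' measurable_snd measurable_snd fun _ _ _ => rfl
  · calc ∫⁻ x, ∫⁻ z, edist (g (y, x, z.1)) (g' (y, x, z.2)) ^ p ∂(c x) ∂(η y)
        ≤ ∫⁻ x, ∫⁻ z, l ^ p * (edist z.1 z.2 + b) ^ p ∂(c x) ∂(η y) := by
          gcongr with x z
          rw [← ENNReal.mul_rpow_of_nonneg _ _ hp0]
          gcongr
          exact hdist y x z.1 z.2
      _ ≤ ∫⁻ _, (l * (d + b)) ^ p ∂(η y) := by
          refine lintegral_mono fun x => ?_
          rw [lintegral_const_mul _ (by fun_prop), ENNReal.mul_rpow_of_nonneg _ _ hp0]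
          gcongr
          exact lintegral_add_rpow_le hp (by fun_prop) (by fun_prop) (hc x) (by simp)
      _ = (l * (d + b)) ^ p := by simp

theorem HasCoupling.penalizedBackup {M : MDP S A} {α α' : Kernel S ℝ} [IsMarkovKernel α]
    (hp : 1 ≤ p) (h : HasCoupling p α α' d) {k k' : S → ℝ} (hk : Measurable k)
    (hk' : Measurable k') {b : ℝ} (hb : ∀ x, |k x - k' x| ≤ b) :
    HasCoupling p (penalizedBackup M k α) (penalizedBackup M k' α')
      (ENNReal.ofReal M.γ * (d + ENNReal.ofReal b)) := by
  refine h.backup hp (measurable_penalized hk) (measurable_penalized hk') fun y x z z' => ?_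
  simp only [edist_dist, Real.dist_eq]
  rw [← ENNReal.ofReal_add (abs_nonneg _) ((abs_nonneg _).trans (hb x)),
    ← ENNReal.ofReal_mul M.γ_pos.le, add_sub_add_left_eq_sub, ← mul_sub, abs_mul,
    abs_of_pos M.γ_pos, sub_sub_sub_comm]
  refine ENNReal.ofReal_le_ofReal (mul_le_mul_of_nonneg_left ?_ M.γ_pos.le)
  exact (abs_sub _ _).trans (add_le_add_right (hb x) _)

theorem ae_actionAverage {π : Kernel S A} {ζ : Kernel (S × A) ℝ} {q : ℝ → Prop}
    (hq : MeasurableSet {z | q z})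
    (h : ∀ y, ∀ᵐ z ∂(ζ y), q z) (x : S) : ∀ᵐ z ∂(actionAverage π ζ x), q z := by
  rw [actionAverage, Kernel.snd_apply, ae_map_iff measurable_snd.aemeasurable hq]
  exact Kernel.ae_compProd_of_ae_ae (measurable_snd hq) (ae_of_all _ fun a => h (x, a))

theorem hasCoupling_actionAverage_of_eq_add {π π' β β' : Kernel S A} [IsMarkovKernel π]
    [IsMarkovKernel π'] [IsSFiniteKernel β] [IsSFiniteKernel β'] {s : ℝ≥0∞} (hπ : π = β + β')
    (hβ : ∀ x, β x = s • π' x) {ζ : Kernel (S × A) ℝ} [IsMarkovKernel ζ] (hp : 1 ≤ p) {C : ℝ}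
    (hC : ∀ y, ∀ᵐ z ∂(ζ y), |z| ≤ C) :
    HasCoupling p (actionAverage π ζ) (actionAverage π' ζ)
      ((1 - s) ^ p⁻¹ * ENNReal.ofReal (2 * C)) := by
  have hmeas : MeasurableSet {z : ℝ | |z| ≤ C} :=
    measurableSet_le measurable_norm measurable_const
  refine hasCoupling_of_eq_add (β := actionAverage β ζ) (β' := actionAverage β' ζ)
    (Kernel.ext fun x => ?_) (fun x => ?_) hp (ae_actionAverage hmeas hC)
    (ae_actionAverage hmeas hC)
  · simp only [actionAverage, hπ, Kernel.compProd_add_left, Kernel.snd_apply, add_apply,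
      Measure.map_add _ _ measurable_snd]
  · refine Measure.ext_of_lintegral _ fun F hF => ?_
    rw [lintegral_actionAverage hF, hβ, lintegral_smul_measure, lintegral_smul_measure,
      lintegral_actionAverage hF]

end CouplingBackup

section SoftReturns

/-- The discounted return of a trajectory, charged the penalty `k` at each state visited from time
`1` on. -/
def penalizedReturn (M : MDP S A) (k : S → ℝ) (w : ℕ → S × A) : ℝ :=
  M.r (w 0) + ∑' t : ℕ, M.γ ^ (t + 1) * (M.r (w (t + 1)) - k (w (t + 1)).1)

variable (M : MDP S A) {k : S → ℝ}

theorem measurable_penalizedReturn (hk : Measurable k) : Measurable (penalizedReturn M k) :=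
  (M.measurable_r.comp (measurable_pi_apply 0)).add <| Measurable.tsum fun t =>
    ((M.measurable_r.comp (measurable_pi_apply (t + 1))).sub
      (hk.comp (measurable_fst.comp (measurable_pi_apply (t + 1))))).const_mul _

theorem discountedReturn_sub_penalizedReturn {K : ℝ} (hK : ∀ x, |k x| ≤ K) (w : ℕ → S × A) :
    discountedReturn M w - penalizedReturn M k w
      = M.γ * ∑' t : ℕ, M.γ ^ t * k (shift w t).1 := by
  obtain ⟨R, hR⟩ := M.bounded_r
  have hreward : Summable fun t => M.γ ^ t * M.r (shift w t) :=
    summable_discounted M.γ_pos.le M.γ_lt_one fun t => hR _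
  have hpenalty : Summable fun t => M.γ ^ t * k (shift w t).1 :=
    summable_discounted M.γ_pos.le M.γ_lt_one fun t => hK _
  have hpenalized : penalizedReturn M k w
      = M.r (w 0) + M.γ * ∑' t : ℕ, (M.γ ^ t * M.r (shift w t) - M.γ ^ t * k (shift w t).1) := by
    rw [penalizedReturn, ← tsum_mul_left]
    simp only [pow_succ', mul_assoc, mul_sub, shift]
  rw [hpenalized, hreward.tsum_sub hpenalty, discountedReturn_eq_add_shift, discountedReturn]
  ring

theorem abs_penalizedReturn_sub_discountedReturn_le {K : ℝ} (hK : ∀ x, |k x| ≤ K)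
    (w : ℕ → S × A) :
    |penalizedReturn M k w - discountedReturn M w| ≤ M.γ * K / (1 - M.γ) := by
  rw [abs_sub_comm, discountedReturn_sub_penalizedReturn M hK, abs_mul, abs_of_pos M.γ_pos,
    mul_div_assoc]
  exact mul_le_mul_of_nonneg_left
    (abs_tsum_discounted_le M.γ_pos.le M.γ_lt_one fun t => hK _) M.γ_pos.le

theorem hasCoupling_softReturnDist {p : ℝ} (hp : 0 ≤ p) {π πref : Kernel S A} [IsMarkovKernel π]
    {τ K : ℝ} (hπ : Measurable (klFn π πref)) (hK : ∀ x, |τ * klFn π πref x| ≤ K) :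
    HasCoupling p (softReturnDist M πref τ π) (returnDist M π)
      (ENNReal.ofReal (M.γ * K / (1 - M.γ))) := by
  have hsoft : softReturnDist M πref τ π
      = (chain (step M π)).map (penalizedReturn M fun x => τ * klFn π πref x) := by
    rw [softReturnDist, dif_pos ‹_›]; rfl
  rw [hsoft, returnDist_eq_map_chain]
  refine hasCoupling_map (measurable_penalizedReturn M (hπ.const_mul τ))
    (measurable_discountedReturn M) hp fun w => ?_
  rw [edist_dist, Real.dist_eq]
  exact ENNReal.ofReal_le_ofReal (abs_penalizedReturn_sub_discountedReturn_le M hK w)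

end SoftReturns

section SoftGap

variable {M : MDP S A} {πref : Kernel S A} {τ k e : ℝ} {q : S × A → ℝ}

/-- At the soft-optimal action values, the essential supremum over actions exceeds the soft value
by at most `k`, uniformly over the states. -/
def SoftGapLE (M : MDP S A) (πref : Kernel S A) (τ k : ℝ) : Prop :=
  ∀ x, essSup (fun a => qSoftStar M πref τ (x, a)) (πref x)
    ≤ softValue πref τ (qSoftStar M πref τ) x + k

theorem IsRefOptimal.mono {ε ε' : ℝ} {π : Kernel S A} (h : IsRefOptimal M πref ε π)
    (hε : ε ≤ ε') : IsRefOptimal M πref ε' π :=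
  ⟨h.1, fun y => (sub_le_sub_left hε _).trans (h.2 y)⟩

theorem mul_klFn_nonneg {π : Kernel S A} (hτ : 0 ≤ τ) (x : S) : 0 ≤ τ * klFn π πref x :=
  mul_nonneg hτ ENNReal.toReal_nonneg

variable [IsMarkovKernel πref]

theorem Coverage.exists_softGapLE (h : Coverage M πref) (hk : 0 < k) :
    ∃ τ, 0 < τ ∧ SoftGapLE M πref τ k := by
  obtain ⟨c, hc0, hc⟩ := h
  set L := Real.log (1 / c)
  have hL : 0 < |L| + 1 := by positivity
  have hτ : 0 < k / (|L| + 1) := by positivity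
  refine ⟨k / (|L| + 1), hτ, fun x => ?_⟩
  have hgap := essSup_le_softValue_add (qSoftStar_spec M πref hτ).1 hτ x hc0
    (hc.trans ((iInf₂_le _ hτ).trans (iInf_le _ x)))
  have hle : k / (|L| + 1) * L ≤ k := by
    rw [div_mul_eq_mul_div, div_le_iff₀ hL]
    exact mul_le_mul_of_nonneg_left (by linarith [le_abs_self L]) hk.le
  linarith

theorem SoftGapLE.abs_mul_klFn_boltzmann_le (h : SoftGapLE M πref τ k) (hτ : 0 < τ)
    (hq : IsBddMeas q) (he : ∀ y, |q y - qSoftStar M πref τ y| ≤ e) (x : S) :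
    |τ * klFn (boltzmann πref τ q) πref x| ≤ k + 2 * e := by
  have hstar := (qSoftStar_spec M πref hτ).1
  rw [abs_of_nonneg (mul_klFn_nonneg hτ.le x)]
  refine mul_klFn_boltzmann_le hq hτ x ?_
  have hsup := (isValueOperator_essSup πref).le_add hq hstar (c := e)
    (fun y => by linarith [(abs_sub_le_iff.1 (he y)).1]) x
  have hsoft := (isValueOperator_softValue πref hτ).le_add hstar hq (c := e)
    (fun y => by linarith [(abs_sub_le_iff.1 (he y)).2]) x
  linarith [h x]

theorem SoftGapLE.qRefStar_le (h : SoftGapLE M πref τ k) (hτ : 0 < τ) (y : S × A) :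
    qRefStar M πref y ≤ qSoftStar M πref τ y + M.γ * k / (1 - M.γ) := by
  obtain ⟨href, href_fix⟩ := qRefStar_spec M πref
  obtain ⟨hstar, hstar_fix⟩ := qSoftStar_spec M πref hτ
  refine le_add_of_bellman_fixedPoint (isValueOperator_essSup πref)
    (isValueOperator_softValue πref hτ) href hstar href_fix hstar_fix (fun C hC x => ?_) y
  linarith [(isValueOperator_essSup πref).le_add href hstar hC x, h x]

theorem qSoftStar_le_qValue_boltzmann (hτ : 0 < τ) (hq : IsBddMeas q)
    (he : ∀ y, |q y - qSoftStar M πref τ y| ≤ e) (y : S × A) :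
    qSoftStar M πref τ y
      ≤ qValue M (boltzmann πref τ q) y + M.γ * (2 * e) / (1 - M.γ) := by
  obtain ⟨hstar, hstar_fix⟩ := qSoftStar_spec M πref hτ
  have := isMarkovKernel_boltzmann (πref := πref) hq hτ
  have hvalue := isBddMeas_qValue M (boltzmann πref τ q)
  have haverage := isValueOperator_integral (boltzmann πref τ q)
  refine le_add_of_bellman_fixedPoint (isValueOperator_softValue πref hτ) haverage hstar hvalue
    hstar_fix (bellman_qValue M _) (fun C hC x => ?_) y
  have hsoft := (isValueOperator_softValue πref hτ).le_add hstar hq (c := e)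
    (fun y => by linarith [(abs_sub_le_iff.1 (he y)).2]) x
  have hkl := mul_klFn_nonneg (π := boltzmann πref τ q) (πref := πref) hτ.le x
  rw [mul_klFn_boltzmann hq hτ] at hkl
  have hmean := haverage.le_add hq hvalue (c := C + e)
    (fun y => by linarith [(abs_sub_le_iff.1 (he y)).1, hC y]) x
  linarith

theorem SoftGapLE.isRefOptimal_boltzmann (h : SoftGapLE M πref τ k) (hτ : 0 < τ)
    (hq : IsBddMeas q) (he : ∀ y, |q y - qSoftStar M πref τ y| ≤ e) :
    IsRefOptimal M πref (M.γ * (k + 2 * e) / (1 - M.γ)) (boltzmann πref τ q) := by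
  refine ⟨isMarkovKernel_boltzmann hq hτ, fun y => ?_⟩
  rw [mul_add, add_div]
  linarith [h.qRefStar_le hτ y, qSoftStar_le_qValue_boltzmann hτ hq he y]

end SoftGap

section ControlIterates

theorem eventually_le_of_affine_recursion {γ L B : ℝ} (hγ0 : 0 ≤ γ) (hγ1 : γ < 1) {a d : ℕ → ℝ}
    (hd : ∀ n, d (n + 1) ≤ γ * (d n + a n)) (ha : Tendsto a atTop (𝓝 L))
    (hB : γ * L / (1 - γ) < B) : ∀ᶠ n in atTop, d n ≤ B := by
  obtain ⟨b, hLb, hbB⟩ := exists_between hB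
  have hγ : 0 < 1 - γ := sub_pos.2 hγ1
  obtain ⟨N, hN⟩ := eventually_atTop.1
    ((ha.const_mul γ).eventually_le_const ((div_lt_iff₀ hγ).1 hLb))
  have hdecay : ∀ m, d (m + N) - b ≤ γ ^ m * (d N - b) := fun m => by
    induction m with
    | zero => simp
    | succ m ih =>
      have hstep := hd (m + N)
      rw [add_right_comm] at hstep
      have := mul_le_mul_of_nonneg_left ih hγ0
      rw [pow_succ', mul_assoc]
      linarith [hN (m + N) (Nat.le_add_left N m)]
  have hlim : Tendsto (fun m => γ ^ m * (d N - b)) atTop (𝓝 0) := by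
    simpa using (tendsto_pow_atTop_nhds_zero_of_lt_one hγ0 hγ1).mul_const (d N - b)
  obtain ⟨m₀, hm₀⟩ := eventually_atTop.1 (hlim.eventually_le_const (sub_pos.2 hbB))
  refine eventually_atTop.2 ⟨m₀ + N, fun n hn => ?_⟩
  obtain ⟨m, rfl⟩ := Nat.exists_eq_add_of_le' (le_of_add_le_right hn)
  linarith [hdecay m, hm₀ m (Nat.le_of_add_le_add_right hn)]

theorem eventually_hasCoupling_of_step {Y : Type*} [MeasurableSpace Y] {p γ L B : ℝ} (hp : 0 ≤ p)
    (hγ0 : 0 ≤ γ) (hγ1 : γ < 1) {κ : ℕ → Kernel Y ℝ} {η : Kernel Y ℝ} {a : ℕ → ℝ}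
    (ha0 : ∀ n, 0 ≤ a n) (ha : Tendsto a atTop (𝓝 L))
    (hinit : ∃ d, d ≠ ∞ ∧ HasCoupling p (κ 0) η d)
    (hstep : ∀ n d, 0 ≤ d → HasCoupling p (κ n) η (ENNReal.ofReal d) →
      HasCoupling p (κ (n + 1)) η (ENNReal.ofReal (γ * (d + a n))))
    (hB : γ * L / (1 - γ) < B) : ∀ᶠ n in atTop, HasCoupling p (κ n) η (ENNReal.ofReal B) := by
  obtain ⟨d₀, hd₀, hcoupling⟩ := hinit
  let d : ℕ → ℝ := fun n => Nat.rec d₀.toReal (fun n c => γ * (c + a n)) n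
  have hd : ∀ n, 0 ≤ d n ∧ HasCoupling p (κ n) η (ENNReal.ofReal (d n)) := fun n => by
    induction n with
    | zero =>
      refine ⟨ENNReal.toReal_nonneg, ?_⟩
      change HasCoupling p (κ 0) η (ENNReal.ofReal d₀.toReal)
      rwa [ENNReal.ofReal_toReal hd₀]
    | succ n ih =>
      exact ⟨mul_nonneg hγ0 (add_nonneg ih.1 (ha0 n)), hstep n (d n) ih.1 ih.2⟩
  filter_upwards [eventually_le_of_affine_recursion hγ0 hγ1 (d := d) (fun _ => le_rfl) ha hB]
    with n hn
  exact (hd n).2.mono hp (ENNReal.ofReal_le_ofReal hn)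

/-- A bound on the `p`-cost of drawing an action from the Boltzmann-Gibbs policy of action values
that are wrong by `e`, before collecting a return in `[-C, C]`. -/
def policyPerturbation (p τ C e : ℝ) : ℝ := (1 - Real.exp (-(2 * e / τ))) ^ p⁻¹ * (2 * C)

variable {M : MDP S A} {πref : Kernel S A} [IsMarkovKernel πref] {p τ k e : ℝ}
  {ζ : Kernel (S × A) ℝ} [IsMarkovKernel ζ]

theorem tendsto_policyPerturbation (hp : 0 < p) (C : ℝ) {e : ℕ → ℝ}
    (he : Tendsto e atTop (𝓝 0)) :
    Tendsto (fun n => policyPerturbation p τ C (e n)) atTop (𝓝 0) := by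
  have hcont : Continuous (policyPerturbation p τ C) := by
    unfold policyPerturbation
    exact ((Real.continuous_rpow_const (by positivity)).comp (by fun_prop)).mul_const _
  have hzero : policyPerturbation p τ C 0 = 0 := by
    simp [policyPerturbation, Real.zero_rpow (inv_ne_zero hp.ne')]
  exact (hcont.tendsto' 0 _ hzero).comp he

theorem one_sub_exp_nonneg (hτ : 0 < τ) (he : 0 ≤ e) : 0 ≤ 1 - Real.exp (-(2 * e / τ)) := by
  rw [sub_nonneg, Real.exp_le_one_iff, neg_nonpos]
  positivity

theorem policyPerturbation_nonneg {C : ℝ} (hC : 0 ≤ C) (hτ : 0 < τ) (he : 0 ≤ e) :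
    0 ≤ policyPerturbation p τ C e :=
  mul_nonneg (Real.rpow_nonneg (one_sub_exp_nonneg hτ he) _) (by positivity)

theorem ofReal_policyPerturbation {C : ℝ} (hp : 0 < p) (hτ : 0 < τ) (he : 0 ≤ e) :
    ENNReal.ofReal (policyPerturbation p τ C e)
      = (1 - ENNReal.ofReal (Real.exp (-(2 * e / τ)))) ^ p⁻¹ * ENNReal.ofReal (2 * C) := by
  have hexp := one_sub_exp_nonneg hτ he
  rw [policyPerturbation, ENNReal.ofReal_mul (Real.rpow_nonneg hexp _),
    ← ENNReal.ofReal_rpow_of_nonneg hexp (inv_nonneg.2 hp.le),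
    ENNReal.ofReal_sub _ (Real.exp_pos _).le, ENNReal.ofReal_one]

theorem hasCoupling_actionAverage_boltzmann {q q' : S × A → ℝ} (hq : IsBddMeas q)
    (hq' : IsBddMeas q') (hp : 1 ≤ p) (hτ : 0 < τ) (he0 : 0 ≤ e) (he : ∀ y, |q y - q' y| ≤ e)
    {C : ℝ} (hC : ∀ y, ∀ᵐ z ∂(ζ y), |z| ≤ C) :
    HasCoupling p (actionAverage (boltzmann πref τ q) ζ) (actionAverage (boltzmann πref τ q') ζ)
      (ENNReal.ofReal (policyPerturbation p τ C e)) := by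
  have := isMarkovKernel_boltzmann (πref := πref) hq hτ
  have := isMarkovKernel_boltzmann (πref := πref) hq' hτ
  obtain ⟨Q, R, _, _, hQR, hQ⟩ := exists_boltzmann_eq_add (πref := πref) hq hq' hτ he
  rw [ofReal_policyPerturbation (by linarith) hτ he0]
  exact hasCoupling_actionAverage_of_eq_add hQR hQ hp hC

theorem isMarkovKernel_piStar (hτ : 0 < τ) : IsMarkovKernel (piStar M πref τ) :=
  isMarkovKernel_boltzmann (qSoftStar_spec M πref hτ).1 hτ

theorem SoftGapLE.hasCoupling_softReturnDist_piStar (hgap : SoftGapLE M πref τ k) (hτ : 0 < τ)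
    (hp : 0 ≤ p) :
    HasCoupling p (softReturnDist M πref τ (piStar M πref τ)) (returnDist M (piStar M πref τ))
      (ENNReal.ofReal (M.γ * k / (1 - M.γ))) := by
  have := isMarkovKernel_piStar (M := M) (πref := πref) hτ
  have hstar := (qSoftStar_spec M πref hτ).1
  refine hasCoupling_softReturnDist M hp (measurable_klFn_boltzmann hstar hτ) fun x => ?_
  simpa [piStar] using hgap.abs_mul_klFn_boltzmann_le hτ hstar (e := 0) (by simp) x

theorem SoftGapLE.isRefOptimal_piStar (hgap : SoftGapLE M πref τ k) (hτ : 0 < τ) :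
    IsRefOptimal M πref (M.γ * k / (1 - M.γ)) (piStar M πref τ) := by
  simpa [piStar] using
    hgap.isRefOptimal_boltzmann hτ (qSoftStar_spec M πref hτ).1 (e := 0) (by simp)

theorem SoftGapLE.hasCoupling_softDistBellmanOpt (hgap : SoftGapLE M πref τ k) (hk : 0 ≤ k)
    (hτ : 0 < τ) (hp : 1 ≤ p) (hζ : IsBddMeas (meanQ ζ)) (he0 : 0 ≤ e)
    (he : ∀ y, |meanQ ζ y - qSoftStar M πref τ y| ≤ e) {R : ℝ} (hR0 : 0 ≤ R)
    (hR : ∀ y, |M.r y| ≤ R) {d : ℝ} (hd0 : 0 ≤ d)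
    (hd : HasCoupling p ζ (returnDist M (piStar M πref τ)) (ENNReal.ofReal d)) :
    HasCoupling p (softDistBellmanOpt M πref τ ζ) (returnDist M (piStar M πref τ))
      (ENNReal.ofReal
        (M.γ * (d + (policyPerturbation p τ (R / (1 - M.γ)) e + (k + 2 * e))))) := by
  have := isMarkovKernel_piStar (M := M) (πref := πref) hτ
  have := isMarkovKernel_boltzmann (πref := πref) hζ hτ
  have hC0 : 0 ≤ R / (1 - M.γ) := div_nonneg hR0 (sub_nonneg.2 M.γ_lt_one.le)
  have haverage : HasCoupling p (actionAverage (boltzmann πref τ (meanQ ζ)) ζ)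
      (actionAverage (piStar M πref τ) (returnDist M (piStar M πref τ))) _ :=
    hd.actionAverage.trans hp (hasCoupling_actionAverage_boltzmann hζ (qSoftStar_spec M πref hτ).1
      hp hτ he0 he (ae_returnDist_abs_le M (piStar M πref τ) hR))
  have hbackup := haverage.penalizedBackup (M := M) (k' := 0) hp
    ((measurable_klFn_boltzmann hζ hτ).const_mul τ) measurable_const
    (by simpa using hgap.abs_mul_klFn_boltzmann_le hτ hζ he)
  rw [← returnDist_eq_penalizedBackup, ← softDistBellmanOpt_eq_penalizedBackup hζ hτ] at hbackup
  rwa [← ENNReal.ofReal_add hd0 (policyPerturbation_nonneg hC0 hτ he0),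
    ← ENNReal.ofReal_add (add_nonneg hd0 (policyPerturbation_nonneg hC0 hτ he0)) (by positivity),
    ← ENNReal.ofReal_mul M.γ_pos.le, add_assoc] at hbackup

theorem HasBoundedMoments.controlIter (hp : 1 ≤ p) (hζ : HasBoundedMoments p ζ) (hτ : 0 < τ)
    (n : ℕ) : IsMarkovKernel (controlIter M πref τ ζ n) ∧
      HasBoundedMoments p (controlIter M πref τ ζ n) := by
  induction n with
  | zero =>
    exact ⟨isMarkovKernel_softDistBellmanOpt (hζ.isBddMeas_meanQ hp) hτ,
      hζ.softDistBellmanOpt hp hτ⟩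
  | succ n ih =>
    obtain ⟨_, hmoments⟩ := ih
    exact ⟨isMarkovKernel_softDistBellmanOpt (hmoments.isBddMeas_meanQ hp) hτ,
      hmoments.softDistBellmanOpt hp hτ⟩

theorem HasBoundedMoments.isBddMeas_meanQ_controlIter (hp : 1 ≤ p) (hζ : HasBoundedMoments p ζ)
    (hτ : 0 < τ) (n : ℕ) : IsBddMeas (meanQ (DERL.controlIter M πref τ ζ n)) :=
  have ⟨_, hmoments⟩ := hζ.controlIter (M := M) (πref := πref) hp hτ n
  hmoments.isBddMeas_meanQ hp

theorem exists_abs_meanQ_controlIter_sub_le (hp : 1 ≤ p) (hζ : HasBoundedMoments p ζ)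
    (hτ : 0 < τ) : ∃ E, 0 ≤ E ∧
      ∀ n y, |meanQ (controlIter M πref τ ζ n) y - qSoftStar M πref τ y| ≤ M.γ ^ n * E := by
  obtain ⟨hstar, hstar_fix⟩ := qSoftStar_spec M πref hτ
  obtain ⟨B, hB⟩ := (hζ.isBddMeas_meanQ_controlIter (M := M) (πref := πref) hp hτ 0).2
  obtain ⟨B', hB'⟩ := hstar.2
  refine ⟨|B| + |B'|, by positivity, fun n => ?_⟩
  induction n with
  | zero =>
    intro y
    rw [pow_zero, one_mul]
    exact (abs_sub _ _).trans (add_le_add ((hB y).trans (le_abs_self B))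
      ((hB' y).trans (le_abs_self B')))
  | succ n ih =>
    intro y
    obtain ⟨_, hmoments⟩ := hζ.controlIter (M := M) (πref := πref) hp hτ n
    rw [controlIter, meanQ_softDistBellmanOpt hp hmoments hτ, pow_succ', mul_assoc]
    conv_lhs => rw [← hstar_fix]
    exact bellman_abs_sub_le (isValueOperator_softValue πref hτ) (hmoments.isBddMeas_meanQ hp)
      hstar ih y

theorem SoftGapLE.eventually_isRefOptimal_controlIter (hgap : SoftGapLE M πref τ k) (hτ : 0 < τ)
    (hp : 1 ≤ p) (hζ : HasBoundedMoments p ζ) {ε : ℝ} (hε : M.γ * k / (1 - M.γ) < ε) :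
    ∀ᶠ n in atTop, IsRefOptimal M πref ε (boltzmann πref τ (meanQ (controlIter M πref τ ζ n))) := by
  obtain ⟨E, -, hE⟩ := exists_abs_meanQ_controlIter_sub_le (M := M) (πref := πref) hp hζ hτ
  have hlim : Tendsto (fun n => M.γ * (k + 2 * (M.γ ^ n * E)) / (1 - M.γ)) atTop
      (𝓝 (M.γ * k / (1 - M.γ))) := by
    have hpow := tendsto_pow_atTop_nhds_zero_of_lt_one M.γ_pos.le M.γ_lt_one
    simpa using ((((hpow.mul_const E).const_mul 2).const_add k).const_mul M.γ).div_const (1 - M.γ)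
  filter_upwards [hlim.eventually_le_const hε] with n hn
  exact (hgap.isRefOptimal_boltzmann hτ (hζ.isBddMeas_meanQ_controlIter hp hτ n) (hE n)).mono hn

theorem SoftGapLE.eventually_hasCoupling_controlIter (hgap : SoftGapLE M πref τ k) (hk : 0 ≤ k)
    (hτ : 0 < τ) (hp : 1 ≤ p) (hζ : HasBoundedMoments p ζ) {δ : ℝ}
    (hδ : M.γ * k / (1 - M.γ) < δ) :
    ∀ᶠ n in atTop, HasCoupling p (controlIter M πref τ ζ n) (returnDist M (piStar M πref τ))
      (ENNReal.ofReal δ) := by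
  have hp0 : 0 < p := by linarith
  have := isMarkovKernel_piStar (M := M) (πref := πref) hτ
  obtain ⟨R, hR⟩ := M.bounded_r
  obtain ⟨E, hE0, hE⟩ := exists_abs_meanQ_controlIter_sub_le (M := M) (πref := πref) hp hζ hτ
  have he0 : ∀ n, 0 ≤ M.γ ^ n * E := fun n => mul_nonneg (pow_nonneg M.γ_pos.le n) hE0
  have he : Tendsto (fun n => M.γ ^ n * E) atTop (𝓝 0) := by
    simpa using (tendsto_pow_atTop_nhds_zero_of_lt_one M.γ_pos.le M.γ_lt_one).mul_const E
  have hC0 : 0 ≤ |R| / (1 - M.γ) := div_nonneg (abs_nonneg R) (sub_nonneg.2 M.γ_lt_one.le)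
  have hlim : Tendsto (fun n => policyPerturbation p τ (|R| / (1 - M.γ)) (M.γ ^ n * E)
      + (k + 2 * (M.γ ^ n * E))) atTop (𝓝 k) := by
    simpa using (tendsto_policyPerturbation hp0 _ he).add ((he.const_mul 2).const_add k)
  obtain ⟨_, hmoments⟩ := hζ.controlIter (M := M) (πref := πref) hp hτ 0
  refine eventually_hasCoupling_of_step hp0.le M.γ_pos.le M.γ_lt_one (fun n => ?_) hlim
    (hmoments.exists_hasCoupling hp (hasBoundedMoments_returnDist M (piStar M πref τ) hp0.le))
    (fun n d hd0 hd => ?_) hδ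
  · exact add_nonneg (policyPerturbation_nonneg hC0 hτ (he0 n)) (by linarith [he0 n])
  · obtain ⟨_, hmoments⟩ := hζ.controlIter (M := M) (πref := πref) hp hτ n
    exact hgap.hasCoupling_softDistBellmanOpt hk hτ hp (hmoments.isBddMeas_meanQ hp) (he0 n) (hE n)
      (abs_nonneg R) (fun y => (hR y).trans (le_abs_self R)) hd0 hd

end ControlIterates

end DERL

end

theorem mainTheorem5_general {S : Type*} {A : Type*} [MeasurableSpace S] [MeasurableSpace A]
    (M : DERL.MDP S A) (πref : Kernel S A) [IsMarkovKernel πref] (hcov : DERL.Coverage M πref)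
    (p : ℝ) (hp : 1 ≤ p) (ε δ : ℝ) (hε : 0 < ε) (hδ : 0 < δ) :
    ∃ τ : ℝ, 0 < τ ∧
      (∀ y, DERL.wass p (DERL.softReturnDist M πref τ (DERL.piStar M πref τ) y)
          (DERL.returnDist M (DERL.piStar M πref τ) y) ≤ ENNReal.ofReal (δ / 2)) ∧
      DERL.IsRefOptimal M πref (ε / 2) (DERL.piStar M πref τ) ∧
      ∀ ζ : Kernel (S × A) ℝ, IsMarkovKernel ζ → DERL.HasBoundedMoments p ζ →
        ∃ N : ℕ, ∀ n, N ≤ n →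
          (∀ y, DERL.wass p (DERL.controlIter M πref τ ζ n y)
              (DERL.returnDist M (DERL.piStar M πref τ) y) ≤ ENNReal.ofReal δ) ∧
          DERL.IsRefOptimal M πref ε
            (DERL.boltzmann πref τ (DERL.meanQ (DERL.controlIter M πref τ ζ n))) := by
  have hp0 : 0 < p := by linarith
  have hγ0 := M.γ_pos
  have hγ1 : 0 < 1 - M.γ := sub_pos.2 M.γ_lt_one
  obtain ⟨k, hk, hkδ, hkε⟩ :
      ∃ k, 0 < k ∧ M.γ * k / (1 - M.γ) ≤ δ / 2 ∧ M.γ * k / (1 - M.γ) ≤ ε / 2 := by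
    refine ⟨(1 - M.γ) / M.γ * min (δ / 2) (ε / 2), by positivity, ?_⟩
    rw [← le_min_iff]
    exact le_of_eq (by field_simp)
  obtain ⟨τ, hτ, hgap⟩ := hcov.exists_softGapLE hk
  refine ⟨τ, hτ, ?_, (hgap.isRefOptimal_piStar hτ).mono hkε,
    fun ζ _ hζ => Filter.eventually_atTop.1 ?_⟩
  · exact ((hgap.hasCoupling_softReturnDist_piStar hτ hp0.le).mono hp0.le
      (ENNReal.ofReal_le_ofReal hkδ)).wass_le hp0
  · filter_upwards [hgap.eventually_hasCoupling_controlIter hk.le hτ hp hζ (by linarith : _ < δ),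
      hgap.eventually_isRefOptimal_controlIter hτ hp hζ (by linarith : _ < ε)] with n hn hopt
    exact ⟨hn.wass_le hp0, hopt⟩

theorem mainTheorem5 {S : Type*} {A : Type*}
    [MeasurableSpace S] [StandardBorelSpace S] [MeasurableSpace A] [StandardBorelSpace A]
    (M : DERL.MDP S A) (πref : Kernel S A) [IsMarkovKernel πref]
    (hcov : DERL.Coverage M πref)
    (p p' : ℝ) (hp : 1 ≤ p) (hp' : 1 ≤ p')
    (ω : Measure (S × A)) [IsProbabilityMeasure ω]
    (ε δ : ℝ) (hε : 0 < ε) (hδ : 0 < δ) :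
    ∃ τ : ℝ, 0 < τ ∧
      DERL.muWass p p' ω
          (DERL.softReturnDist M πref τ (DERL.piStar M πref τ))
          (DERL.returnDist M (DERL.piStar M πref τ)) ≤ ENNReal.ofReal (δ / 2) ∧
      DERL.IsRefOptimal M πref (ε / 2) (DERL.piStar M πref τ) ∧
      ∀ ζ : Kernel (S × A) ℝ, IsMarkovKernel ζ → DERL.HasBoundedMoments p ζ →
        ∃ N : ℕ, ∀ n, N ≤ n →
          DERL.muWass p p' ω (DERL.controlIter M πref τ ζ n)
              (DERL.returnDist M (DERL.piStar M πref τ)) ≤ ENNReal.ofReal δ ∧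
          DERL.IsRefOptimal M πref ε
            (DERL.boltzmann πref τ (DERL.meanQ (DERL.controlIter M πref τ ζ n))) := by
  obtain ⟨τ, hτ, hsoft, hopt, hiter⟩ := mainTheorem5_general M πref hcov p hp ε δ hε hδ
  exact ⟨τ, hτ, DERL.muWass_le_of_forall hp' hsoft, hopt, fun ζ hmarkov hζ =>
    (hiter ζ hmarkov hζ).imp fun N hN n hn =>
      ⟨DERL.muWass_le_of_forall hp' (hN n hn).1, (hN n hn).2⟩⟩
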